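/- A seller offers two items to one buyer. A menu item $[(x_1,x_2),p]$ consists of allocation probabilities $x_1,x_2\in[0,1]$ and a price $p\ge 0$. A mechanism is a nonempty set of actions, each leading to a menu item, one of them (exiting) leading to the zero item $[(0,0),0]$; its menu is the set of distinct menu items so offered, and its menu size is the cardinality of the menu, the zero item included. The buyer is additive with values $v=(v_1,v_2)\sim U[0,1]^2$; at value $v$ she picks an action maximizing $v_1x_1+v_2x_2-p$, with ties broken arbitrarily. The revenue is the expected payment. **Theorem.** Among all mechanisms with at most three menu items, the maximal revenue is $59/108$. For every rational buyer strategy the revenue of such a mechanism is well defined and at most $59/108$, with equality if and only if its menu is $$\{[(0,0),0],\ [(1,0),2/3],\ [(1,1),5/6]\}\quad\text{or}\quad\{[(0,0),0],\ [(0,1),2/3],\ [(1,1),5/6]\},$$ that is, the mechanism sells the first item alone at price $2/3$ or the bundle at price $5/6$, or is the mirror image, which sells the second item alone at price $2/3$ or the bundle at price $5/6$. Both menus are attained by mechanisms against which a rational buyer strategy exists. In particular, no optimal mechanism with at most three menu items has a menu that is invariant under exchanging the two items, although the distribution $U[0,1]^2$ is. -/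

import Mathlib

open MeasureTheory Set

noncomputable section

namespace MenuDesign

/-- An outcome (menu item) for `m` items: the probabilities with which the items are
allocated, together with a nonnegative payment. -/
@[ext]
structure Outcome (m : ℕ) where
  alloc : Fin m → ℝ
  price : ℝ
  alloc_mem : ∀ i, alloc i ∈ Icc (0 : ℝ) 1
  price_nonneg : 0 ≤ price

/-- The zero menu item: nothing is allocated and nothing is paid. -/
def Outcome.zero (m : ℕ) : Outcome m where
  alloc := fun _ => 0
  price := 0
  alloc_mem := fun _ => ⟨le_rfl, zero_le_one⟩
  price_nonneg := le_rfl

/-- The menu item that sells the set `S` of items, with certainty, at price `p`. -/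
def Outcome.sell {m : ℕ} (S : Finset (Fin m)) (p : ℝ) (hp : 0 ≤ p) : Outcome m where
  alloc := fun i => if i ∈ S then 1 else 0
  price := p
  alloc_mem := fun i => by
    split_ifs
    · exact ⟨zero_le_one, le_rfl⟩
    · exact ⟨le_rfl, zero_le_one⟩
  price_nonneg := hp

/-- The outcome obtained by renaming item `i` to `σ i`. -/
def Outcome.relabel {m : ℕ} (σ : Equiv.Perm (Fin m)) (o : Outcome m) : Outcome m where
  alloc := fun i => o.alloc (σ.symm i)
  price := o.price
  alloc_mem := fun i => o.alloc_mem (σ.symm i)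
  price_nonneg := o.price_nonneg

/-- Quasi-linear utility of an additive buyer with item values `v`. -/
def Outcome.utility {m : ℕ} (o : Outcome m) (v : Fin m → ℝ) : ℝ :=
  ∑ i, v i * o.alloc i - o.price

/-- A naive mechanism: every action of the buyer leads to an outcome, and there is an
action `exit` that leads to the zero outcome. -/
structure NaiveMechanism (m : ℕ) (A : Type*) where
  outcome : A → Outcome m
  exit : A
  outcome_exit : outcome exit = Outcome.zero m

/-- The menu of a mechanism: the set of its distinct outcomes, the zero menu item included. -/
def NaiveMechanism.menu {m : ℕ} {A : Type*} (M : NaiveMechanism m A) : Set (Outcome m) :=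
  range M.outcome

/-- A mechanism is symmetric if its menu is invariant under all permutations of the items. -/
def NaiveMechanism.IsSymmetric {m : ℕ} {A : Type*} (M : NaiveMechanism m A) : Prop :=
  ∀ σ : Equiv.Perm (Fin m), Outcome.relabel σ '' M.menu = M.menu

/-- The strategy `s` of the buyer is rational on the set `V` of possible values: at every
value in `V` it picks a utility-maximizing action. Ties may be broken in any way. -/
def NaiveMechanism.IsRational {m : ℕ} {A : Type*} (M : NaiveMechanism m A)
    (V : Set (Fin m → ℝ)) (s : (Fin m → ℝ) → A) : Prop :=
  ∀ v ∈ V, ∀ a : A, (M.outcome a).utility v ≤ (M.outcome (s v)).utility v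

/-- The payment of a buyer with values `v` who follows the strategy `s`. -/
def NaiveMechanism.payment {m : ℕ} {A : Type*} (M : NaiveMechanism m A)
    (s : (Fin m → ℝ) → A) (v : Fin m → ℝ) : ℝ :=
  (M.outcome (s v)).price

/-- Expected revenue when the values are drawn from `F`. -/
def NaiveMechanism.revenue {m : ℕ} {A : Type*} (M : NaiveMechanism m A)
    (F : Measure (Fin m → ℝ)) (s : (Fin m → ℝ) → A) : ℝ :=
  ∫ v, M.payment s v ∂F

/-- The unit square `[0,1]²`. -/
def unitSquare : Set (Fin 2 → ℝ) := Icc 0 1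

/-- The uniform distribution `U[0,1]²`. -/
def uniformSquare : Measure (Fin 2 → ℝ) := volume.restrict unitSquare

instance : IsProbabilityMeasure uniformSquare :=
  ⟨by simp [uniformSquare, unitSquare, Real.volume_Icc_pi]⟩

/-- Menu of the mechanism that sells item `i` alone at price `2/3` or the bundle of both
items at price `5/6`. Here `0` is the first item and `1` is the second item. -/
def itemOrBundleMenu (i : Fin 2) : Set (Outcome 2) :=
  {Outcome.zero 2, Outcome.sell {i} (2 / 3) (by norm_num),
    Outcome.sell Finset.univ (5 / 6) (by norm_num)}

end MenuDesign

end

/-! Besides the zero item the menu holds two items, with utilities f(v) = a·v - p and g(v) = b·v -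
q. If one is attractive only where the other is, revenue splits into a base sale and an upgrade, and
is at most 109/200, which lies between the best bundle revenue (2/3)^(3/2) and 59/108
(`revenue_le_of_nested`). Otherwise f and g have a common zero (x, y) in the square
(`exists_common_zero`). Then p = a·(x, y) and q = b·(x, y), so revenue is x times the expected
allocation of the first good plus y times that of the second. The utility is convex with the
allocation as a subgradient, so each expected allocation is a difference of utility integrals over
opposite edges (`expected_alloc_fst`, `expected_alloc_snd`). This turns revenue into the edge
functional `revenueAt`.

For fixed (x, y) that functional is homogeneous in (a, b), so up to mirroring the second item
allocates some good with certainty. The larger `revenueBound` is moreover convex in the scale of the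
first item, so only extreme scales matter. At the small end the first item is superfluous (the
corner lemmas); at the large end it too allocates a good with certainty. If both items are sure of
the same good, one of them can be improved to the bundle (`revenueBound_mono`). There remain the
items (1, α) and (β, 1). For x + y ≤ 1 an explicit bound is quadratic in A = 1 - α and B = 1 - β,
with constant term the revenue of the bundle at price x + y; completing the square reduces the claim
to an identity in x and y (`mul_max_le_of_sq_eq`). For x + y ≥ 1 cruder estimates suffice. Following
equality through these steps leaves the two menus. -/

noncomputable section

namespace MenuDesign

/-! ### Integrals of subgradients over the line and the square -/

/-- The integral of a selection of subgradients of a continuous function on the line. -/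
theorem integral_eq_sub_of_subgradient {u φ : ℝ → ℝ} (hu : Continuous u)
    (h : ∀ s s', u s + φ s * (s' - s) ≤ u s') (a b : ℝ) :
    ∫ s in a..b, φ s = u b - u a := by
  have hmono : Monotone φ := by
    intro s s' hss
    rcases hss.eq_or_lt with rfl | hlt
    · rfl
    · nlinarith [h s s', h s' s]
  refine MeasureTheory.integral_eq_of_hasDerivAt_off_countable u φ hmono.countable_not_continuousAt
    hu.continuousOn ?_ hmono.intervalIntegrable
  rintro s ⟨-, hs⟩
  have hc : ContinuousAt φ s := by simpa using hs
  rw [hasDerivAt_iff_tendsto_slope]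
  have h1 : Filter.Tendsto φ (nhdsWithin s {s}ᶜ) (nhds (φ s)) := hc.mono_left nhdsWithin_le_nhds
  rw [tendsto_iff_dist_tendsto_zero] at h1 ⊢
  -- The difference quotient of `u` lies between `φ s` and `φ z`, so continuity of `φ` at `s` makes
  -- it converge.
  refine squeeze_zero' (Filter.Eventually.of_forall fun _ => dist_nonneg) ?_ h1
  filter_upwards [self_mem_nhdsWithin] with z hz
  have hz' : z ≠ s := hz
  rw [Real.dist_eq, Real.dist_eq, slope_def_field]
  rcases lt_or_gt_of_ne hz' with hlt | hgt
  · have e1 : φ z ≤ (u z - u s) / (z - s) := by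
      rw [le_div_iff_of_neg (by linarith)]; nlinarith [h z s]
    have e2 : (u z - u s) / (z - s) ≤ φ s := by
      rw [div_le_iff_of_neg (by linarith)]; nlinarith [h s z]
    rw [abs_of_nonpos (by linarith), abs_of_nonpos (by linarith)]; linarith
  · have e1 : (u z - u s) / (z - s) ≤ φ z := by
      rw [div_le_iff₀ (by linarith)]; nlinarith [h z s]
    have e2 : φ s ≤ (u z - u s) / (z - s) := by
      rw [le_div_iff₀ (by linarith)]; nlinarith [h s z]
    rw [abs_of_nonneg (by linarith), abs_of_nonneg (by linarith)]; linarith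

/-- The uniform distribution on the unit square of `ℝ × ℝ`. -/
def squareMeasure : Measure (ℝ × ℝ) := volume.restrict (Icc 0 1 ×ˢ Icc 0 1)

theorem squareMeasure_eq_prod :
    squareMeasure = (volume.restrict (Icc (0 : ℝ) 1)).prod (volume.restrict (Icc (0 : ℝ) 1)) := by
  rw [squareMeasure, Measure.prod_restrict]; rfl

instance : IsProbabilityMeasure squareMeasure := by
  rw [squareMeasure_eq_prod]
  have : IsProbabilityMeasure (volume.restrict (Icc (0 : ℝ) 1)) := ⟨by simp⟩
  infer_instance

theorem integral_square_fst {φ U : ℝ × ℝ → ℝ} (hφ : Integrable φ squareMeasure)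
    (hU : Continuous U) (h : ∀ s s' t, U (s, t) + φ (s, t) * (s' - s) ≤ U (s', t)) :
    ∫ z, φ z ∂squareMeasure = (∫ t in (0 : ℝ)..1, U (1, t)) - ∫ t in (0 : ℝ)..1, U (0, t) := by
  rw [squareMeasure_eq_prod] at hφ ⊢
  rw [integral_prod_symm _ hφ, ← intervalIntegral.integral_sub
    (Continuous.intervalIntegrable (by fun_prop) _ _)
    (Continuous.intervalIntegrable (by fun_prop) _ _),
    intervalIntegral.integral_of_le zero_le_one, integral_Icc_eq_integral_Ioc]
  congr 1; funext t
  rw [integral_Icc_eq_integral_Ioc, ← intervalIntegral.integral_of_le zero_le_one]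
  exact integral_eq_sub_of_subgradient (u := fun s => U (s, t)) (φ := fun s => φ (s, t))
    (by fun_prop) (fun s s' => h s s' t) 0 1

theorem integral_square_snd {φ U : ℝ × ℝ → ℝ} (hφ : Integrable φ squareMeasure)
    (hU : Continuous U) (h : ∀ s t t', U (s, t) + φ (s, t) * (t' - t) ≤ U (s, t')) :
    ∫ z, φ z ∂squareMeasure = (∫ t in (0 : ℝ)..1, U (t, 1)) - ∫ t in (0 : ℝ)..1, U (t, 0) := by
  rw [squareMeasure_eq_prod] at hφ ⊢
  rw [integral_prod _ hφ, ← intervalIntegral.integral_sub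
    (Continuous.intervalIntegrable (by fun_prop) _ _)
    (Continuous.intervalIntegrable (by fun_prop) _ _),
    intervalIntegral.integral_of_le zero_le_one, integral_Icc_eq_integral_Ioc]
  congr 1; funext s
  rw [integral_Icc_eq_integral_Ioc, ← intervalIntegral.integral_of_le zero_le_one]
  exact integral_eq_sub_of_subgradient (u := fun t => U (s, t)) (φ := fun t => φ (s, t))
    (by fun_prop) (fun t t' => h s t t') 0 1

/-! ### Expected allocations as differences of edge integrals -/

/-- The values at which the first of the two items `(a₁, a₂, p)` and `(b₁, b₂, q)` is chosen. -/
def firstRegion (a₁ a₂ p b₁ b₂ q : ℝ) : Set (ℝ × ℝ) :=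
  {z | 0 < a₁ * z.1 + a₂ * z.2 - p ∧ b₁ * z.1 + b₂ * z.2 - q ≤ a₁ * z.1 + a₂ * z.2 - p}

/-- The values at which the second of the two items `(a₁, a₂, p)` and `(b₁, b₂, q)` is chosen. -/
def secondRegion (a₁ a₂ p b₁ b₂ q : ℝ) : Set (ℝ × ℝ) :=
  {z | 0 < b₁ * z.1 + b₂ * z.2 - q ∧ a₁ * z.1 + a₂ * z.2 - p < b₁ * z.1 + b₂ * z.2 - q}

theorem measurableSet_firstRegion (a₁ a₂ p b₁ b₂ q : ℝ) :
    MeasurableSet (firstRegion a₁ a₂ p b₁ b₂ q) := by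
  rw [firstRegion, ofPred_and]
  exact (measurableSet_lt (by fun_prop) (by fun_prop)).inter
    (measurableSet_le (by fun_prop) (by fun_prop))

theorem measurableSet_secondRegion (a₁ a₂ p b₁ b₂ q : ℝ) :
    MeasurableSet (secondRegion a₁ a₂ p b₁ b₂ q) := by
  rw [secondRegion, ofPred_and]
  exact (measurableSet_lt (by fun_prop) (by fun_prop)).inter
    (measurableSet_lt (by fun_prop) (by fun_prop))

theorem integral_indicator_const_add {S T : Set (ℝ × ℝ)} (hS : MeasurableSet S)
    (hT : MeasurableSet T) (c d : ℝ) :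
    Integrable (fun z => S.indicator (fun _ => c) z + T.indicator (fun _ => d) z) squareMeasure ∧
    ∫ z, S.indicator (fun _ => c) z + T.indicator (fun _ => d) z ∂squareMeasure =
      c * squareMeasure.real S + d * squareMeasure.real T := by
  have h1 : Integrable (S.indicator fun _ => c) squareMeasure := (integrable_const c).indicator hS
  have h2 : Integrable (T.indicator fun _ => d) squareMeasure := (integrable_const d).indicator hT
  refine ⟨h1.add h2, ?_⟩
  rw [integral_add h1 h2, integral_indicator hS, integral_indicator hT]
  simp [mul_comm]

/-- The utility from the best of the items `(a₁, a₂, p)` and `(b₁, b₂, q)` and of exiting. -/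
def bestUtility (a₁ a₂ p b₁ b₂ q : ℝ) (z : ℝ × ℝ) : ℝ :=
  max 0 (max (a₁ * z.1 + a₂ * z.2 - p) (b₁ * z.1 + b₂ * z.2 - q))

/-- A maximum of affine functions is convex, and the slope of an active piece is a subgradient;
exiting is the piece of slope zero. -/
theorem bestUtility_subgradient (a₁ a₂ p b₁ b₂ q : ℝ) (z z' : ℝ × ℝ) :
    bestUtility a₁ a₂ p b₁ b₂ q z +
      ((firstRegion a₁ a₂ p b₁ b₂ q).indicator (fun _ => a₁) z +
        (secondRegion a₁ a₂ p b₁ b₂ q).indicator (fun _ => b₁) z) * (z'.1 - z.1) +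
      ((firstRegion a₁ a₂ p b₁ b₂ q).indicator (fun _ => a₂) z +
        (secondRegion a₁ a₂ p b₁ b₂ q).indicator (fun _ => b₂) z) * (z'.2 - z.2) ≤
    bestUtility a₁ a₂ p b₁ b₂ q z' := by
  have h1 : a₁ * z'.1 + a₂ * z'.2 - p ≤ bestUtility a₁ a₂ p b₁ b₂ q z' := by
    simp [bestUtility]
  have h2 : b₁ * z'.1 + b₂ * z'.2 - q ≤ bestUtility a₁ a₂ p b₁ b₂ q z' := by
    simp [bestUtility]
  have h0 : 0 ≤ bestUtility a₁ a₂ p b₁ b₂ q z' := by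
    simp [bestUtility]
  by_cases hA : z ∈ firstRegion a₁ a₂ p b₁ b₂ q
  · have hB : z ∉ secondRegion a₁ a₂ p b₁ b₂ q := fun hB => absurd hA.2 (not_le.2 hB.2)
    have : bestUtility a₁ a₂ p b₁ b₂ q z = a₁ * z.1 + a₂ * z.2 - p := by
      rw [bestUtility, max_eq_left hA.2, max_eq_right hA.1.le]
    simp only [indicator_of_mem hA, indicator_of_notMem hB, this]
    linarith
  · by_cases hB : z ∈ secondRegion a₁ a₂ p b₁ b₂ q
    · have : bestUtility a₁ a₂ p b₁ b₂ q z = b₁ * z.1 + b₂ * z.2 - q := by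
        rw [bestUtility, max_eq_right hB.2.le, max_eq_right hB.1.le]
      simp only [indicator_of_notMem hA, indicator_of_mem hB, this]
      linarith
    · have : bestUtility a₁ a₂ p b₁ b₂ q z = 0 := by
        rw [bestUtility]
        refine max_eq_left (not_lt.1 fun hlt => ?_)
        rcases le_or_gt (b₁ * z.1 + b₂ * z.2 - q) (a₁ * z.1 + a₂ * z.2 - p) with h | h
        · rw [max_eq_left h] at hlt; exact hA ⟨hlt, h⟩
        · rw [max_eq_right h.le] at hlt; exact hB ⟨hlt, h⟩
      simp only [indicator_of_notMem hA, indicator_of_notMem hB, this]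
      linarith

theorem continuous_bestUtility (a₁ a₂ p b₁ b₂ q : ℝ) :
    Continuous (bestUtility a₁ a₂ p b₁ b₂ q) := by
  unfold bestUtility; fun_prop

/-- The expected allocation of the first good, as a difference of integrals over two edges. -/
theorem expected_alloc_fst (a₁ a₂ p b₁ b₂ q : ℝ) :
    a₁ * squareMeasure.real (firstRegion a₁ a₂ p b₁ b₂ q) +
      b₁ * squareMeasure.real (secondRegion a₁ a₂ p b₁ b₂ q) =
    (∫ t in (0 : ℝ)..1, bestUtility a₁ a₂ p b₁ b₂ q (1, t)) -
      ∫ t in (0 : ℝ)..1, bestUtility a₁ a₂ p b₁ b₂ q (0, t) := by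
  obtain ⟨hi, he⟩ := integral_indicator_const_add (measurableSet_firstRegion a₁ a₂ p b₁ b₂ q)
    (measurableSet_secondRegion a₁ a₂ p b₁ b₂ q) a₁ b₁
  rw [← he]
  refine integral_square_fst hi (continuous_bestUtility a₁ a₂ p b₁ b₂ q) fun s s' t => ?_
  simpa using bestUtility_subgradient a₁ a₂ p b₁ b₂ q (s, t) (s', t)

/-- The expected allocation of the second good, as a difference of integrals over two edges. -/
theorem expected_alloc_snd (a₁ a₂ p b₁ b₂ q : ℝ) :
    a₂ * squareMeasure.real (firstRegion a₁ a₂ p b₁ b₂ q) +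
      b₂ * squareMeasure.real (secondRegion a₁ a₂ p b₁ b₂ q) =
    (∫ t in (0 : ℝ)..1, bestUtility a₁ a₂ p b₁ b₂ q (t, 1)) -
      ∫ t in (0 : ℝ)..1, bestUtility a₁ a₂ p b₁ b₂ q (t, 0) := by
  obtain ⟨hi, he⟩ := integral_indicator_const_add (measurableSet_firstRegion a₁ a₂ p b₁ b₂ q)
    (measurableSet_secondRegion a₁ a₂ p b₁ b₂ q) a₂ b₂
  rw [← he]
  refine integral_square_snd hi (continuous_bestUtility a₁ a₂ p b₁ b₂ q) fun s t t' => ?_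
  simpa using bestUtility_subgradient a₁ a₂ p b₁ b₂ q (s, t) (s, t')

/-! ### Revenue of a mechanism in terms of the two choice regions -/

theorem Outcome.utility_two (o : Outcome 2) (v : Fin 2 → ℝ) :
    o.utility v = o.alloc 0 * v 0 + o.alloc 1 * v 1 - o.price := by
  simp [Outcome.utility, Fin.sum_univ_two, mul_comm]

/-- Two distinct outcomes are almost never equally good. -/
theorem Outcome.volume_utility_eq {m : ℕ} {o o' : Outcome m} (h : o ≠ o') :
    volume {v : Fin m → ℝ | o.utility v = o'.utility v} = 0 := by
  -- The ties form a translate of the kernel of the allocation difference. If that kernel were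
  -- everything, the allocations would agree and the tie at `v₀` would force equal prices.
  let L : (Fin m → ℝ) →ₗ[ℝ] ℝ :=
    ∑ i, (o.alloc i - o'.alloc i) • (LinearMap.proj i : (Fin m → ℝ) →ₗ[ℝ] ℝ)
  have hL : ∀ v, L v = (o.utility v + o.price) - (o'.utility v + o'.price) := by
    intro v
    simp only [L, Outcome.utility, LinearMap.sum_apply, LinearMap.smul_apply, LinearMap.proj_apply,
      smul_eq_mul, sub_add_cancel, ← Finset.sum_sub_distrib]
    exact Finset.sum_congr rfl fun i _ => by ring
  rcases Set.eq_empty_or_nonempty {v : Fin m → ℝ | o.utility v = o'.utility v} with he | ⟨v₀, hv₀⟩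
  · rw [he, measure_empty]
  have hv₀' : o.utility v₀ = o'.utility v₀ := hv₀
  have hset : {v : Fin m → ℝ | o.utility v = o'.utility v} =
      (fun v => v - v₀) ⁻¹' (LinearMap.ker L : Set (Fin m → ℝ)) := by
    ext v
    simp only [mem_ofPred_eq, mem_preimage, SetLike.mem_coe, LinearMap.mem_ker]
    rw [map_sub, hL, hL]
    constructor <;> intro h <;> linarith
  simp only [sub_eq_add_neg] at hset
  rw [hset, measure_preimage_add_right]
  refine Measure.addHaar_submodule _ _ fun htop => h ?_
  have hz : L = 0 := LinearMap.ker_eq_top.1 htop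
  have ha : o.alloc = o'.alloc := by
    funext i
    have := congrArg (fun K : (Fin m → ℝ) →ₗ[ℝ] ℝ => K (Pi.single i 1)) hz
    simp [L, LinearMap.sum_apply, Pi.single_apply] at this
    linarith
  refine Outcome.ext ha ?_
  simp only [Outcome.utility, ha] at hv₀'
  linarith

theorem measurePreserving_uniformSquare :
    MeasurePreserving (MeasurableEquiv.finTwoArrow (α := ℝ)) uniformSquare squareMeasure := by
  have h := (volume_preserving_finTwoArrow ℝ).restrict_preimage_emb
    (MeasurableEquiv.measurableEmbedding _) (Icc (0 : ℝ) 1 ×ˢ Icc (0 : ℝ) 1)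
  have hs : (MeasurableEquiv.finTwoArrow (α := ℝ)) ⁻¹' (Icc (0 : ℝ) 1 ×ˢ Icc (0 : ℝ) 1) =
      unitSquare := by
    ext v
    simp [unitSquare, Pi.le_def, Fin.forall_fin_two]
  rw [hs] at h
  exact h

/-- The revenue of a mechanism whose menu is given by two items. -/
theorem revenue_eq {A : Type*} {M : NaiveMechanism 2 A} {s : (Fin 2 → ℝ) → A} {o o' : Outcome 2}
    (hM : M.menu = {Outcome.zero 2, o, o'}) (hs : M.IsRational unitSquare s) :
    Integrable (M.payment s) uniformSquare ∧
    M.revenue uniformSquare s =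
      o.price * squareMeasure.real (firstRegion (o.alloc 0) (o.alloc 1) o.price
        (o'.alloc 0) (o'.alloc 1) o'.price) +
      o'.price * squareMeasure.real (secondRegion (o.alloc 0) (o.alloc 1) o.price
        (o'.alloc 0) (o'.alloc 1) o'.price) := by
  set S := firstRegion (o.alloc 0) (o.alloc 1) o.price (o'.alloc 0) (o'.alloc 1) o'.price with hS
  set T := secondRegion (o.alloc 0) (o.alloc 1) o.price (o'.alloc 0) (o'.alloc 1) o'.price with hT
  set φ : ℝ × ℝ → ℝ := fun z => S.indicator (fun _ => o.price) z + T.indicator (fun _ => o'.price) z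
    with hφ
  obtain ⟨hi, he⟩ := integral_indicator_const_add (measurableSet_firstRegion (o.alloc 0)
    (o.alloc 1) o.price (o'.alloc 0) (o'.alloc 1) o'.price) (measurableSet_secondRegion
    (o.alloc 0) (o.alloc 1) o.price (o'.alloc 0) (o'.alloc 1) o'.price) o.price o'.price
  -- Ties are turned into equality of outcomes instead of being excluded, because the three listed
  -- outcomes may coincide.
  have hne : ∀ o₁ o₂ : Outcome 2, ∀ᵐ v ∂uniformSquare, o₁.utility v = o₂.utility v → o₁ = o₂ := by
    intro o₁ o₂
    by_cases h : o₁ = o₂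
    · exact Filter.Eventually.of_forall fun _ _ => h
    · have h0 : ∀ᵐ v : Fin 2 → ℝ, ¬ o₁.utility v = o₂.utility v := by
        rw [ae_iff]; simpa using Outcome.volume_utility_eq h
      filter_upwards [ae_restrict_of_ae h0] with v hv hv' using absurd hv' hv
  have hzero : ∀ v, (Outcome.zero 2).utility v = 0 := by
    intro v; simp [Outcome.utility, Outcome.zero]
  have hae : M.payment s =ᵐ[uniformSquare] φ ∘ MeasurableEquiv.finTwoArrow := by
    have hmem : ∀ᵐ v ∂uniformSquare, v ∈ unitSquare :=
      ae_restrict_mem (by unfold unitSquare; exact measurableSet_Icc)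
    filter_upwards [hmem, hne o (Outcome.zero 2), hne o' (Outcome.zero 2), hne o o']
      with v hv h1 h2 h3
    have hbest : ∀ x ∈ M.menu, x.utility v ≤ (M.outcome (s v)).utility v := by
      rintro x ⟨a, rfl⟩; exact hs v hv a
    rw [hM] at hbest
    have b0 := hbest _ (mem_insert _ _)
    have b1 := hbest o (by simp)
    have b2 := hbest o' (by simp)
    have hin : M.outcome (s v) ∈ ({Outcome.zero 2, o, o'} : Set (Outcome 2)) := by
      rw [← hM]; exact mem_range_self _
    have e1 := o.utility_two v
    have e2 := o'.utility_two v
    have hmS : (v 0, v 1) ∈ S ↔ 0 < o.utility v ∧ o'.utility v ≤ o.utility v := by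
      rw [e1, e2]; exact Iff.rfl
    have hmT : (v 0, v 1) ∈ T ↔ 0 < o'.utility v ∧ o.utility v < o'.utility v := by
      rw [e1, e2]; exact Iff.rfl
    rw [hzero] at h1 h2 b0
    have hv2 : (MeasurableEquiv.finTwoArrow v : ℝ × ℝ) = (v 0, v 1) := rfl
    simp only [Function.comp, hv2, hφ, NaiveMechanism.payment]
    simp only [mem_insert_iff, mem_singleton_iff] at hin
    rcases hin with hin | hin | hin
    · rw [hin] at b1 b2 ⊢
      rw [hzero] at b1 b2
      rw [indicator_of_notMem (by rw [hmS]; rintro ⟨h, -⟩; linarith),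
        indicator_of_notMem (by rw [hmT]; rintro ⟨h, -⟩; linarith)]
      simp [Outcome.zero]
    · rw [hin] at b0 b1 b2 ⊢
      rw [indicator_of_notMem (s := T) (by rw [hmT]; rintro ⟨h, h'⟩; linarith)]
      rcases b0.eq_or_lt with h | h
      · have := h1 h.symm
        rw [indicator_of_notMem (by rw [hmS]; rintro ⟨h, -⟩; linarith), this]
        simp [Outcome.zero]
      · rw [indicator_of_mem (hmS.2 ⟨h, b2⟩)]; simp
    · rw [hin] at b0 b1 b2 ⊢
      rcases b0.eq_or_lt with h | h
      · have := h2 h.symm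
        rw [indicator_of_notMem (by rw [hmS]; rintro ⟨h, -⟩; linarith),
          indicator_of_notMem (by rw [hmT]; rintro ⟨h, -⟩; linarith), this]
        simp [Outcome.zero]
      · rcases b1.eq_or_lt with h' | h'
        · have := h3 h'
          rw [indicator_of_notMem (s := T) (by rw [hmT]; rintro ⟨_, _⟩; linarith),
            indicator_of_mem (hmS.2 ⟨by linarith, h'.ge⟩), this]; simp
        · rw [indicator_of_notMem (s := S) (by rw [hmS]; rintro ⟨_, _⟩; linarith),
            indicator_of_mem (hmT.2 ⟨h, h'⟩)]; simp
  have hi' : Integrable (φ ∘ MeasurableEquiv.finTwoArrow) uniformSquare :=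
    (measurePreserving_uniformSquare.integrable_comp_emb
      (MeasurableEquiv.measurableEmbedding _)).2 hi
  refine ⟨hi'.congr hae.symm, ?_⟩
  rw [NaiveMechanism.revenue, integral_congr_ae hae]
  exact (measurePreserving_uniformSquare.integral_comp
    (MeasurableEquiv.measurableEmbedding _) φ).trans he

/-! ### Integrals of positive parts -/

theorem hasDerivAt_half_sq_pos (z : ℝ) : HasDerivAt (fun w : ℝ => (max 0 w) ^ 2 / 2) (max 0 z) z := by
  rcases lt_trichotomy z 0 with h | h | h
  · rw [max_eq_left h.le]
    refine (hasDerivAt_const z (0 : ℝ)).congr_of_eventuallyEq ?_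
    filter_upwards [Iio_mem_nhds h] with w hw
    simp [max_eq_left (le_of_lt (show w < 0 from hw))]
  · subst h
    rw [max_self, hasDerivAt_iff_isLittleO_nhds_zero]
    refine Asymptotics.IsBigO.trans_isLittleO (g := fun w : ℝ => w ^ 2) ?_ ?_
    · refine Asymptotics.IsBigO.of_bound 1 (Filter.Eventually.of_forall fun w => ?_)
      simp only [zero_add, max_self, smul_zero, sub_zero, Real.norm_eq_abs]
      have h1 : (max 0 w) ^ 2 ≤ w ^ 2 := by
        rcases le_total 0 w with h | h
        · rw [max_eq_right h]
        · rw [max_eq_left h]; nlinarith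
      rw [abs_of_nonneg (by nlinarith [sq_nonneg (max 0 w)]), abs_of_nonneg (by positivity)]
      nlinarith [sq_nonneg (max 0 w)]
    · simpa using Asymptotics.isLittleO_pow_id (one_lt_two)
  · rw [max_eq_right h.le]
    have : HasDerivAt (fun w : ℝ => w ^ 2 / 2) z z := by
      simpa using (hasDerivAt_pow 2 z).div_const 2
    refine this.congr_of_eventuallyEq ?_
    filter_upwards [Ioi_mem_nhds h] with w hw
    simp [max_eq_right (le_of_lt (show 0 < w from hw))]

/-- The integral of the positive part of an affine function over the unit interval. -/
theorem integral_pos_part_affine (m c : ℝ) :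
    m * ∫ t in (0 : ℝ)..1, max 0 (m * t + c) = (max 0 (m + c)) ^ 2 / 2 - (max 0 c) ^ 2 / 2 := by
  rw [← intervalIntegral.integral_const_mul]
  have := intervalIntegral.integral_eq_sub_of_hasDerivAt (a := 0) (b := 1)
    (f := fun t : ℝ => (max 0 (m * t + c)) ^ 2 / 2) (f' := fun t => m * max 0 (m * t + c))
    (fun t _ => by
      have h1 : HasDerivAt (fun t : ℝ => m * t + c) m t := by
        simpa using ((hasDerivAt_id t).const_mul m).add_const c
      have h2 := (hasDerivAt_half_sq_pos (m * t + c)).comp t h1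
      rw [mul_comm m]
      exact h2)
    (Continuous.intervalIntegrable (by fun_prop) _ _)
  rw [this]; simp

theorem integral_pos_part_sub {c : ℝ} (h0 : 0 ≤ c) :
    ∫ t in (0 : ℝ)..1, max 0 (t - c) = (max 0 (1 - c)) ^ 2 / 2 := by
  have := integral_pos_part_affine 1 (-c)
  simp only [one_mul, max_eq_left (neg_nonpos.2 h0)] at this
  simpa [sub_eq_add_neg] using this

theorem integral_pos_part_sub' {c : ℝ} (h0 : 0 ≤ c) (h1 : c ≤ 1) :
    ∫ t in (0 : ℝ)..1, max 0 (c - t) = c ^ 2 / 2 := by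
  have := integral_pos_part_affine (-1) c
  rw [max_eq_left (by linarith), max_eq_right h0] at this
  have h2 : ∀ t : ℝ, c - t = -1 * t + c := fun t => by ring
  simp only [h2]; linarith

/-! ### Revenue from a single item and from nested items -/

/-- The measure of the part of the unit square on which the item `(d₁, d₂, r)` gives positive
utility. -/
def demand (d₁ d₂ r : ℝ) : ℝ := squareMeasure.real {z | 0 < d₁ * z.1 + d₂ * z.2 - r}

theorem demand_eq_secondRegion {b₁ b₂ q : ℝ} :
    demand b₁ b₂ q = squareMeasure.real (secondRegion 0 0 0 b₁ b₂ q) := by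
  rw [demand]
  congr 1
  ext z
  simp [secondRegion]

theorem demand_mul_fst (d₁ d₂ r : ℝ) : d₁ * demand d₁ d₂ r =
    (∫ t in (0 : ℝ)..1, max 0 (d₂ * t + (d₁ - r))) - ∫ t in (0 : ℝ)..1, max 0 (d₂ * t + -r) := by
  have h := expected_alloc_fst 0 0 0 d₁ d₂ r
  rw [zero_mul, zero_add, ← demand_eq_secondRegion] at h
  rw [h]
  congr 2 <;> funext t <;> simp [bestUtility] <;> ring_nf

theorem demand_mul_snd (d₁ d₂ r : ℝ) : d₂ * demand d₁ d₂ r =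
    (∫ t in (0 : ℝ)..1, max 0 (d₁ * t + (d₂ - r))) - ∫ t in (0 : ℝ)..1, max 0 (d₁ * t + -r) := by
  have h := expected_alloc_snd 0 0 0 d₁ d₂ r
  rw [zero_mul, zero_add, ← demand_eq_secondRegion] at h
  rw [h]
  congr 2 <;> funext t <;> simp [bestUtility] <;> ring_nf

/-- For positive coefficients: the triangle cut off at the corner (1, 1), minus its two overhangs
beyond the square. The factor `d₁ * d₂` avoids division. -/
theorem demand_mul_mul {d₁ d₂ r : ℝ} (hr : 0 ≤ r) : d₁ * d₂ * demand d₁ d₂ r =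
    ((max 0 (d₁ + d₂ - r)) ^ 2 - (max 0 (d₁ - r)) ^ 2 - (max 0 (d₂ - r)) ^ 2) / 2 := by
  have h1 := integral_pos_part_affine d₂ (d₁ - r)
  have h2 := integral_pos_part_affine d₂ (-r)
  have h3 := demand_mul_fst d₁ d₂ r
  rw [max_eq_left (neg_nonpos.2 hr)] at h2
  have e1 : d₂ + (d₁ - r) = d₁ + d₂ - r := by ring
  have e2 : d₂ + -r = d₂ - r := by ring
  rw [e1] at h1
  rw [e2] at h2
  linear_combination d₂ * h3 + h1 - h2

theorem demand_mul_fst_of_zero {d₁ r : ℝ} (hr : 0 ≤ r) :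
    d₁ * demand d₁ 0 r = max 0 (d₁ - r) := by
  rw [demand_mul_fst]; simp [hr]

theorem demand_mul_snd_of_zero {d₂ r : ℝ} (hr : 0 ≤ r) :
    d₂ * demand 0 d₂ r = max 0 (d₂ - r) := by
  rw [demand_mul_snd]; simp [hr]

/-- A bound linear in `d₁ + d₂` can be added up over successive upgrades. The bundle, `d₁ = d₂`,
reaches the ratio (2/3)^(3/2)/2 ≈ 0.27217, and 109/400 is a rational slightly above it. The area is
a free variable `V` so that the case with the coefficients exchanged can be reduced to this one. -/
theorem mul_demand_le_aux {d₁ d₂ r V : ℝ} (h2 : 0 < d₂) (h12 : d₂ ≤ d₁) (hr : 0 ≤ r)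
    (hV : d₁ * d₂ * V =
      ((max 0 (d₁ + d₂ - r)) ^ 2 - (max 0 (d₁ - r)) ^ 2 - (max 0 (d₂ - r)) ^ 2) / 2) :
    r * V ≤ 109 / 400 * (d₁ + d₂) := by
  have h1 : 0 < d₁ := by linarith
  have hd : 0 < d₁ * d₂ := by positivity
  have key : r * (d₁ * d₂ * V) ≤ 109 / 400 * (d₁ + d₂) * (d₁ * d₂) →
      r * V ≤ 109 / 400 * (d₁ + d₂) := by
    intro h
    refine le_of_mul_le_mul_right ?_ hd
    linarith
  apply key
  rw [hV]
  rcases le_total r d₂ with hr2 | hr2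
  · rw [max_eq_right (by linarith), max_eq_right (by linarith), max_eq_right (by linarith)]
    -- the quantity is `d₁ d₂ - r² / 2`
    set σ := d₁ + d₂ with hσ
    have hσ0 : 0 < σ := by positivity
    have hq : 4 * (d₁ * d₂) ≤ σ ^ 2 := by nlinarith [sq_nonneg (d₁ - d₂)]
    have hz : 2 * r ≤ σ := by linarith
    have hcub : r * σ ^ 2 - 2 * r ^ 3 ≤ 109 / 400 * σ ^ 3 := by
      -- 51/125 approximates 1/√6, the value of `r / σ` that maximizes the cubic.
      have := mul_nonneg (sq_nonneg (r - 51 / 125 * σ)) (by positivity : 0 ≤ r + 102 / 125 * σ)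
      nlinarith [mul_nonneg hr (sq_nonneg σ), pow_pos hσ0 3,
        mul_nonneg (sub_nonneg.2 hz) (sq_nonneg σ)]
    have e : ((σ - r) ^ 2 - (d₁ - r) ^ 2 - (d₂ - r) ^ 2) / 2 = d₁ * d₂ - r ^ 2 / 2 := by
      rw [hσ]; ring
    rw [e]
    -- `r (P - r²/2) ≤ κ σ P` for `P = d₁ d₂`, linear in `P`
    have hP : r * (d₁ * d₂) - r ^ 3 / 2 - 109 / 400 * σ * (d₁ * d₂) ≤ 0 := by
      rcases le_total r (109 / 400 * σ) with h | h
      · nlinarith [pow_nonneg hr 3, mul_nonneg (sub_nonneg.2 h) hd.le]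
      · nlinarith [mul_le_mul_of_nonneg_left hq (sub_nonneg.2 h)]
    linarith
  · rw [max_eq_left (by linarith : d₂ - r ≤ 0)]
    rcases le_total r d₁ with hr1 | hr1
    · rw [max_eq_right (by linarith), max_eq_right (by linarith)]
      have e : r * (((d₁ + d₂ - r) ^ 2 - (d₁ - r) ^ 2 - 0 ^ 2) / 2) =
        d₂ * (r * (d₁ + d₂ / 2 - r)) := by ring
      rw [e]
      have h : r * (d₁ + d₂ / 2 - r) ≤ 109 / 400 * (d₁ + d₂) * d₁ := by
        rcases le_total (4 / 5 * d₁) d₂ with h | h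
        · nlinarith [mul_nonneg (sub_nonneg.2 hr2) (sub_nonneg.2 hr1),
            mul_nonneg (sub_nonneg.2 hr2) (sub_nonneg.2 h), mul_nonneg h2.le h1.le,
            sq_nonneg (d₁ - d₂), mul_nonneg (sub_nonneg.2 hr2) h1.le,
            mul_nonneg (sub_nonneg.2 h) h1.le]
        · nlinarith [sq_nonneg (r - (d₁ + d₂ / 2) / 2), mul_nonneg (sub_nonneg.2 h) h1.le,
            mul_nonneg (sub_nonneg.2 h) h2.le]
      nlinarith [mul_le_mul_of_nonneg_left h h2.le]
    · rw [max_eq_left (by linarith : d₁ - r ≤ 0)]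
      rcases le_total (d₁ + d₂) r with hs | hs
      · rw [max_eq_left (by linarith)]; norm_num; positivity
      · rw [max_eq_right (by linarith)]
        have a1 : (d₁ + d₂ - r) ^ 2 ≤ d₂ * (d₁ + d₂ - r) := by nlinarith
        have a2 : r * (d₁ + d₂ - r) ≤ (d₁ + d₂) ^ 2 / 4 := by
          nlinarith [sq_nonneg (r - (d₁ + d₂) / 2)]
        have a3 : (d₁ + d₂) ^ 2 ≤ (d₁ + d₂) * (2 * d₁) := by nlinarith
        have a4 := mul_le_mul_of_nonneg_left a1 hr
        have a5 := mul_le_mul_of_nonneg_left a2 h2.le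
        have a6 := mul_le_mul_of_nonneg_left a3 h2.le
        have : 0 ≤ (d₁ + d₂) * (d₁ * d₂) := by positivity
        nlinarith

theorem mul_demand_le_of_nonneg {d₁ d₂ r : ℝ} (h1 : 0 ≤ d₁) (h2 : 0 ≤ d₂) (hr : 0 ≤ r) :
    r * demand d₁ d₂ r ≤ 109 / 400 * (d₁ + d₂) := by
  have hzero : ∀ d V : ℝ, 0 < d → d * V = max 0 (d - r) → r * V ≤ 109 / 400 * d := by
    intro d V hd hV
    refine le_of_mul_le_mul_left ?_ hd
    have : d * (r * V) = r * (d * V) := by ring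
    rw [this, hV]
    rcases le_total d r with h | h
    · rw [max_eq_left (by linarith)]; nlinarith
    · rw [max_eq_right (by linarith)]; nlinarith [sq_nonneg (r - d / 2)]
  rcases h1.eq_or_lt with rfl | h1'
  · rcases h2.eq_or_lt with rfl | h2'
    · have : demand 0 0 r = 0 := by
        have he : {z : ℝ × ℝ | 0 < 0 * z.1 + 0 * z.2 - r} = ∅ := by
          ext z; simp [hr]
        rw [demand, he, measureReal_empty]
      rw [this]; simp
    · simpa using hzero d₂ _ h2' (demand_mul_snd_of_zero hr)
  · rcases h2.eq_or_lt with rfl | h2'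
    · simpa using hzero d₁ _ h1' (demand_mul_fst_of_zero hr)
    · rcases le_total d₂ d₁ with h | h
      · exact mul_demand_le_aux h2' h hr (demand_mul_mul hr)
      · rw [add_comm]
        refine mul_demand_le_aux h1' h hr ?_
        rw [mul_comm d₂, demand_mul_mul hr, add_comm d₂]
        ring

theorem measureReal_square_mono {S T : Set (ℝ × ℝ)}
    (h : ∀ z : ℝ × ℝ, 0 ≤ z.1 → z.1 ≤ 1 → 0 ≤ z.2 → z.2 ≤ 1 → z ∈ S → z ∈ T) :
    squareMeasure.real S ≤ squareMeasure.real T := by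
  refine ENNReal.toReal_mono (measure_ne_top _ _) (measure_mono_ae ?_)
  have hm : ∀ᵐ z ∂squareMeasure, z ∈ Icc (0 : ℝ) 1 ×ˢ Icc (0 : ℝ) 1 :=
    ae_restrict_mem (measurableSet_Icc.prod measurableSet_Icc)
  filter_upwards [hm] with z hz hzS
  exact h z hz.1.1 hz.1.2 hz.2.1 hz.2.2 hzS

/-- The revenue from a single item is at most `109 / 400` times its total allocation. -/
theorem mul_demand_le {r : ℝ} (d₁ d₂ : ℝ) (hr : 0 ≤ r) :
    r * demand d₁ d₂ r ≤ 109 / 400 * (max 0 d₁ + max 0 d₂) := by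
  -- Negative coefficients arise for differences of items; replacing them by zero only enlarges the
  -- region.
  refine le_trans (mul_le_mul_of_nonneg_left ?_ hr)
    (mul_demand_le_of_nonneg (le_max_left 0 d₁) (le_max_left 0 d₂) hr)
  refine measureReal_square_mono fun z h1 _ h2 _ hz => ?_
  have hz' : 0 < d₁ * z.1 + d₂ * z.2 - r := hz
  show 0 < max 0 d₁ * z.1 + max 0 d₂ * z.2 - r
  have := mul_le_mul_of_nonneg_right (le_max_right 0 d₁) h1
  have := mul_le_mul_of_nonneg_right (le_max_right 0 d₂) h2
  linarith

/-- If the second item is only attractive where the first one is, then the two items together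
raise at most as much as the best bundle price. -/
theorem revenue_le_of_nested {a₁ a₂ p b₁ b₂ q : ℝ} (ha₁ : a₁ ∈ Icc (0 : ℝ) 1)
    (ha₂ : a₂ ∈ Icc (0 : ℝ) 1) (hp : 0 ≤ p) (hb₁ : b₁ ∈ Icc (0 : ℝ) 1) (hb₂ : b₂ ∈ Icc (0 : ℝ) 1)
    (h : ∀ z : ℝ × ℝ, 0 ≤ z.1 → z.1 ≤ 1 → 0 ≤ z.2 → z.2 ≤ 1 →
      0 < b₁ * z.1 + b₂ * z.2 - q → 0 < a₁ * z.1 + a₂ * z.2 - p) :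
    p * squareMeasure.real (firstRegion a₁ a₂ p b₁ b₂ q) +
      q * squareMeasure.real (secondRegion a₁ a₂ p b₁ b₂ q) ≤ 109 / 200 := by
  set S := firstRegion a₁ a₂ p b₁ b₂ q with hS
  set T := secondRegion a₁ a₂ p b₁ b₂ q with hT
  have hdisj : Disjoint S T := by
    rw [Set.disjoint_left]
    intro z h1 h2
    exact absurd h1.2 (not_le.2 h2.2)
  have hunion : squareMeasure.real S + squareMeasure.real T ≤ demand a₁ a₂ p := by
    rw [← measureReal_union hdisj (measurableSet_secondRegion _ _ _ _ _ _)]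
    refine measureReal_square_mono fun z h1 h2 h3 h4 hz => ?_
    rcases hz with hz | hz
    · exact hz.1
    · exact h z h1 h2 h3 h4 hz.1
  have h1 := mul_demand_le a₁ a₂ hp
  rw [max_eq_right ha₁.1, max_eq_right ha₂.1] at h1
  have hT0 : 0 ≤ squareMeasure.real T := measureReal_nonneg
  have hpu := mul_le_mul_of_nonneg_left hunion hp
  rcases le_total q p with hqp | hqp
  · nlinarith [ha₁.2, ha₂.2]
  -- Buyers of the second item pay `p` and an upgrade fee `q - p`; the upgrade is itself a single
  -- item with allocation `b - a`. The two allocation totals add up to at most 2.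
  · have h2 := mul_demand_le (r := q - p) (b₁ - a₁) (b₂ - a₂) (by linarith)
    have hT' : squareMeasure.real T ≤ demand (b₁ - a₁) (b₂ - a₂) (q - p) := by
      refine measureReal_mono fun z hz => ?_
      have := hz.2
      show 0 < (b₁ - a₁) * z.1 + (b₂ - a₂) * z.2 - (q - p)
      linarith
    have h3 := mul_le_mul_of_nonneg_left hT' (sub_nonneg.2 hqp)
    have m1 : max 0 (b₁ - a₁) ≤ 1 - a₁ := max_le (by linarith [ha₁.2]) (by linarith [hb₁.2])
    have m2 : max 0 (b₂ - a₂) ≤ 1 - a₂ := max_le (by linarith [ha₂.2]) (by linarith [hb₂.2])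
    linarith

/-! ### Revenue as an edge functional at a common zero -/

/-- The integral, over an edge of the unit square, of the utility from the best of two items that
both give utility `0` at a common point; `c` is the signed distance of the edge from that point
and `y` is the coordinate of that point along the edge. -/
def edge (c y a₁ a₂ b₁ b₂ : ℝ) : ℝ :=
  ∫ t in (0 : ℝ)..1, max 0 (max (a₁ * c + a₂ * (t - y)) (b₁ * c + b₂ * (t - y)))

theorem edge_le_integral {c y a₁ a₂ b₁ b₂ : ℝ} {g : ℝ → ℝ} (hg : Continuous g)
    (h : ∀ t, 0 ≤ t → t ≤ 1 →
      max 0 (max (a₁ * c + a₂ * (t - y)) (b₁ * c + b₂ * (t - y))) ≤ g t) :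
    edge c y a₁ a₂ b₁ b₂ ≤ ∫ t in (0 : ℝ)..1, g t :=
  intervalIntegral.integral_mono_on zero_le_one
    (Continuous.intervalIntegrable (by fun_prop) _ _) (hg.intervalIntegrable _ _)
    fun t ht => h t ht.1 ht.2

theorem edge_le_edge {c y a₁ a₂ b₁ b₂ a₁' a₂' b₁' b₂' : ℝ}
    (h : ∀ t, 0 ≤ t → t ≤ 1 →
      max 0 (max (a₁ * c + a₂ * (t - y)) (b₁ * c + b₂ * (t - y))) ≤
        max 0 (max (a₁' * c + a₂' * (t - y)) (b₁' * c + b₂' * (t - y)))) :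
    edge c y a₁ a₂ b₁ b₂ ≤ edge c y a₁' a₂' b₁' b₂' :=
  edge_le_integral (by fun_prop) h

theorem edge_zero_left_le (c y a₁ a₂ b₁ b₂ : ℝ) : edge c y 0 0 b₁ b₂ ≤ edge c y a₁ a₂ b₁ b₂ := by
  refine edge_le_edge fun t _ _ => ?_
  simp only [zero_mul, add_zero]
  refine max_le (le_max_left _ _) (max_le (le_max_left _ _) ?_)
  exact (le_max_right _ _).trans (le_max_right _ _)

theorem edge_comm (c y a₁ a₂ b₁ b₂ : ℝ) : edge c y a₁ a₂ b₁ b₂ = edge c y b₁ b₂ a₁ a₂ := by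
  unfold edge; simp only [max_comm (a₁ * c + _)]

theorem edge_zero_right_le (c y a₁ a₂ b₁ b₂ : ℝ) : edge c y a₁ a₂ 0 0 ≤ edge c y a₁ a₂ b₁ b₂ := by
  rw [edge_comm, edge_comm c y a₁]; exact edge_zero_left_le _ _ _ _ _ _

theorem edge_smul {θ : ℝ} (hθ : 0 ≤ θ) (c y a₁ a₂ b₁ b₂ : ℝ) :
    edge c y (θ * a₁) (θ * a₂) (θ * b₁) (θ * b₂) = θ * edge c y a₁ a₂ b₁ b₂ := by
  unfold edge
  rw [← intervalIntegral.integral_const_mul]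
  congr 1; funext t
  rw [mul_max_of_nonneg _ _ hθ, mul_max_of_nonneg _ _ hθ, mul_zero]
  ring_nf

/-- Scaling one of the two items is a convex operation on edge integrals. -/
theorem edge_convex {θ : ℝ} (h0 : 0 ≤ θ) (h1 : θ ≤ 1) (c y a₁ a₂ b₁ b₂ r s : ℝ) :
    edge c y (((1 - θ) * r + θ * s) * a₁) (((1 - θ) * r + θ * s) * a₂) b₁ b₂ ≤
      (1 - θ) * edge c y (r * a₁) (r * a₂) b₁ b₂ + θ * edge c y (s * a₁) (s * a₂) b₁ b₂ := by
  have e : (1 - θ) * edge c y (r * a₁) (r * a₂) b₁ b₂ + θ * edge c y (s * a₁) (s * a₂) b₁ b₂ =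
      ∫ t in (0 : ℝ)..1,
        ((1 - θ) * max 0 (max (r * a₁ * c + r * a₂ * (t - y)) (b₁ * c + b₂ * (t - y))) +
        θ * max 0 (max (s * a₁ * c + s * a₂ * (t - y)) (b₁ * c + b₂ * (t - y)))) := by
    rw [intervalIntegral.integral_add (Continuous.intervalIntegrable (by fun_prop) _ _)
      (Continuous.intervalIntegrable (by fun_prop) _ _), intervalIntegral.integral_const_mul,
      intervalIntegral.integral_const_mul, edge, edge]
  rw [e]
  refine edge_le_integral (by fun_prop) fun t _ _ => ?_
  set F := a₁ * c + a₂ * (t - y)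
  set G := b₁ * c + b₂ * (t - y)
  have hθ' : 0 ≤ 1 - θ := by linarith
  have hF : ∀ l : ℝ, l * a₁ * c + l * a₂ * (t - y) = l * F := fun l => by simp only [F]; ring
  rw [hF, hF, hF]
  have p1 : 0 ≤ max 0 (max (r * F) G) := le_max_left _ _
  have p2 : 0 ≤ max 0 (max (s * F) G) := le_max_left _ _
  have q1 : r * F ≤ max 0 (max (r * F) G) := (le_max_left _ _).trans (le_max_right _ _)
  have q2 : s * F ≤ max 0 (max (s * F) G) := (le_max_left _ _).trans (le_max_right _ _)
  have r1 : G ≤ max 0 (max (r * F) G) := (le_max_right _ _).trans (le_max_right _ _)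
  have r2 : G ≤ max 0 (max (s * F) G) := (le_max_right _ _).trans (le_max_right _ _)
  refine max_le (by positivity) (max_le ?_ ?_)
  · nlinarith [mul_le_mul_of_nonneg_left q1 hθ', mul_le_mul_of_nonneg_left q2 h0]
  · nlinarith [mul_le_mul_of_nonneg_left r1 hθ', mul_le_mul_of_nonneg_left r2 h0]

/-- The revenue from two items that both give utility `0` at `(x, y)`. -/
def revenueAt (x y a₁ a₂ b₁ b₂ : ℝ) : ℝ :=
  x * (edge (1 - x) y a₁ a₂ b₁ b₂ - edge (-x) y a₁ a₂ b₁ b₂) +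
    y * (edge (1 - y) x a₂ a₁ b₂ b₁ - edge (-y) x a₂ a₁ b₂ b₁)

/-- An upper bound on the revenue, which disregards the first item on the left edge and the second
item on the bottom edge of the unit square. -/
def revenueBound (x y a₁ a₂ b₁ b₂ : ℝ) : ℝ :=
  x * (edge (1 - x) y a₁ a₂ b₁ b₂ - edge (-x) y 0 0 b₁ b₂) +
    y * (edge (1 - y) x a₂ a₁ b₂ b₁ - edge (-y) x a₂ a₁ 0 0)

theorem revenueAt_eq (x y a₁ a₂ b₁ b₂ : ℝ) :
    (a₁ * x + a₂ * y) *
        squareMeasure.real (firstRegion a₁ a₂ (a₁ * x + a₂ * y) b₁ b₂ (b₁ * x + b₂ * y)) +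
      (b₁ * x + b₂ * y) *
        squareMeasure.real (secondRegion a₁ a₂ (a₁ * x + a₂ * y) b₁ b₂ (b₁ * x + b₂ * y)) =
      revenueAt x y a₁ a₂ b₁ b₂ := by
  have h1 := expected_alloc_fst a₁ a₂ (a₁ * x + a₂ * y) b₁ b₂ (b₁ * x + b₂ * y)
  have h2 := expected_alloc_snd a₁ a₂ (a₁ * x + a₂ * y) b₁ b₂ (b₁ * x + b₂ * y)
  have e1 : ∀ c, ∫ t in (0 : ℝ)..1,
      bestUtility a₁ a₂ (a₁ * x + a₂ * y) b₁ b₂ (b₁ * x + b₂ * y) (c, t) =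
      edge (c - x) y a₁ a₂ b₁ b₂ := by
    intro c; unfold edge bestUtility; congr 1; funext t; ring_nf
  have e2 : ∀ c, ∫ t in (0 : ℝ)..1,
      bestUtility a₁ a₂ (a₁ * x + a₂ * y) b₁ b₂ (b₁ * x + b₂ * y) (t, c) =
      edge (c - y) x a₂ a₁ b₂ b₁ := by
    intro c; unfold edge bestUtility; congr 1; funext t; ring_nf
  rw [e1, e1, zero_sub] at h1
  rw [e2, e2, zero_sub] at h2
  rw [revenueAt, ← h1, ← h2]
  ring

theorem revenueAt_mirror (x y a₁ a₂ b₁ b₂ : ℝ) :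
    revenueAt y x b₂ b₁ a₂ a₁ = revenueAt x y a₁ a₂ b₁ b₂ := by
  unfold revenueAt
  rw [edge_comm (1 - x), edge_comm (-x), edge_comm (1 - y), edge_comm (-y), add_comm]

theorem revenueBound_mirror (x y a₁ a₂ b₁ b₂ : ℝ) :
    revenueBound y x b₂ b₁ a₂ a₁ = revenueBound x y a₁ a₂ b₁ b₂ := by
  unfold revenueBound
  rw [edge_comm (1 - x), edge_comm (-x), edge_comm (1 - y), edge_comm (-y), add_comm]

theorem revenueAt_smul {θ : ℝ} (hθ : 0 ≤ θ) (x y a₁ a₂ b₁ b₂ : ℝ) :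
    revenueAt x y (θ * a₁) (θ * a₂) (θ * b₁) (θ * b₂) = θ * revenueAt x y a₁ a₂ b₁ b₂ := by
  unfold revenueAt
  simp only [edge_smul hθ]
  ring

theorem revenueAt_le_revenueBound {x y : ℝ} (hx : 0 ≤ x) (hy : 0 ≤ y) (a₁ a₂ b₁ b₂ : ℝ) :
    revenueAt x y a₁ a₂ b₁ b₂ ≤ revenueBound x y a₁ a₂ b₁ b₂ := by
  have h1 := mul_le_mul_of_nonneg_left (edge_zero_left_le (-x) y a₁ a₂ b₁ b₂) hx
  have h2 := mul_le_mul_of_nonneg_left (edge_zero_right_le (-y) x a₂ a₁ b₂ b₁) hy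
  unfold revenueAt revenueBound
  linarith

/-- Of the subtracted edges, the left one does not contain the scaled item, and on the bottom one
that item stands alone, so its integral is linear in the scale. The added edges are convex. With
both items on the subtracted edges, as in `revenueAt`, this argument would fail. -/
theorem revenueBound_convex {x y θ r s : ℝ} (hx : 0 ≤ x) (hy : 0 ≤ y) (h0 : 0 ≤ θ) (h1 : θ ≤ 1)
    (hr : 0 ≤ r) (hs : 0 ≤ s) (a₁ a₂ b₁ b₂ : ℝ) :
    revenueBound x y (((1 - θ) * r + θ * s) * a₁) (((1 - θ) * r + θ * s) * a₂) b₁ b₂ ≤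
      (1 - θ) * revenueBound x y (r * a₁) (r * a₂) b₁ b₂ +
        θ * revenueBound x y (s * a₁) (s * a₂) b₁ b₂ := by
  have e1 := mul_le_mul_of_nonneg_left (edge_convex h0 h1 (1 - x) y a₁ a₂ b₁ b₂ r s) hx
  have e2 := mul_le_mul_of_nonneg_left (edge_convex h0 h1 (1 - y) x a₂ a₁ b₂ b₁ r s) hy
  have e3 : ∀ l : ℝ, 0 ≤ l → edge (-y) x (l * a₂) (l * a₁) 0 0 = l * edge (-y) x a₂ a₁ 0 0 := by
    intro l hl
    simpa using edge_smul hl (-y) x a₂ a₁ 0 0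
  have hl : 0 ≤ (1 - θ) * r + θ * s := by
    have : 0 ≤ 1 - θ := by linarith
    positivity
  unfold revenueBound
  rw [e3 _ hl, e3 _ hr, e3 _ hs]
  linarith

theorem revenueAt_zero_le {x y b₁ b₂ : ℝ} (hx : 0 ≤ x) (hy : 0 ≤ y) (hb₁ : b₁ ∈ Icc (0 : ℝ) 1)
    (hb₂ : b₂ ∈ Icc (0 : ℝ) 1) : revenueAt x y 0 0 b₁ b₂ ≤ 109 / 200 := by
  have h := revenueAt_eq x y 0 0 b₁ b₂
  simp only [zero_mul, add_zero, zero_add] at h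
  rw [← h, ← demand_eq_secondRegion]
  have := mul_demand_le_of_nonneg hb₁.1 hb₂.1
    (by have := hb₁.1; have := hb₂.1; positivity : 0 ≤ b₁ * x + b₂ * y)
  linarith [hb₁.2, hb₂.2]

/-! ### Comparison of the two items at the bottom right corner -/

section Corner

variable {x y a₁ a₂ b₁ b₂ : ℝ}

/-- If at the bottom right corner the second item is at least as good as the first, and the first
one is not useless, then on the opposite edges the first one is never needed. -/
theorem corner_compare (ha₁ : 0 ≤ a₁) (ha₂ : 0 ≤ a₂) (hx1 : x ≤ 1) (hy0 : 0 ≤ y)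
    (hD : 0 ≤ a₁ * b₂ - a₂ * b₁) (hf : 0 < a₁ * (1 - x) - a₂ * y)
    (hfg : a₁ * (1 - x) - a₂ * y ≤ b₁ * (1 - x) - b₂ * y) {w₁ w₂ : ℝ}
    (hw : 0 ≤ w₁ ∧ 0 ≤ (1 - x) * w₂ + y * w₁ ∨ 0 ≤ w₂) :
    a₁ * w₁ + a₂ * w₂ ≤ max 0 (b₁ * w₁ + b₂ * w₂) := by
  rcases le_or_gt (a₁ * w₁ + a₂ * w₂) 0 with h | h
  · exact h.trans (le_max_left _ _)
  refine le_trans ?_ (le_max_right _ _)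
  have hx1' : 0 ≤ 1 - x := by linarith
  have hcross : 0 ≤ (1 - x) * w₂ + y * w₁ := by
    rcases hw with hw | hw
    · exact hw.2
    rcases le_total 0 w₁ with h1 | h1
    · positivity
    have ha₁' : 0 < a₁ := by
      rcases ha₁.eq_or_lt with h' | h'
      · rw [← h'] at hf; nlinarith
      · exact h'
    by_contra hneg
    push Not at hneg
    nlinarith [mul_nonneg ha₂ hw, mul_nonneg ha₂ hy0]
  -- The last factor is the cross product of the displacement to the corner with `w`: turning
  -- counterclockwise from the corner favours the second item, since the determinant is nonnegative.
  have key : (a₁ * (1 - x) - a₂ * y) * (b₁ * w₁ + b₂ * w₂) -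
      (a₁ * w₁ + a₂ * w₂) * (b₁ * (1 - x) - b₂ * y) =
      (a₁ * b₂ - a₂ * b₁) * ((1 - x) * w₂ + y * w₁) := by ring
  have h1 := mul_nonneg hD hcross
  have h2 := mul_le_mul_of_nonneg_left hfg h.le
  refine le_of_mul_le_mul_left ?_ hf
  linarith

theorem edges_le_of_corner (ha₁ : 0 ≤ a₁) (ha₂ : 0 ≤ a₂) (hx1 : x ≤ 1) (hy0 : 0 ≤ y)
    (hy1 : y ≤ 1) (hD : 0 ≤ a₁ * b₂ - a₂ * b₁) (hf : 0 < a₁ * (1 - x) - a₂ * y)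
    (hfg : a₁ * (1 - x) - a₂ * y ≤ b₁ * (1 - x) - b₂ * y) :
    edge (1 - x) y a₁ a₂ b₁ b₂ ≤ edge (1 - x) y 0 0 b₁ b₂ ∧
      edge (1 - y) x a₂ a₁ b₂ b₁ ≤ edge (1 - y) x 0 0 b₂ b₁ := by
  have hx1' : 0 ≤ 1 - x := by linarith
  constructor
  · refine edge_le_edge fun t h0 _ => ?_
    have h := corner_compare ha₁ ha₂ hx1 hy0 hD hf hfg (w₁ := 1 - x) (w₂ := t - y)
      (Or.inl ⟨hx1', by nlinarith [mul_nonneg hx1' h0]⟩)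
    simp only [zero_mul, add_zero]
    rw [← max_assoc 0 0, max_self]
    exact max_le (le_max_left _ _) (max_le h (le_max_right _ _))
  · refine edge_le_edge fun t h0 _ => ?_
    have h := corner_compare ha₁ ha₂ hx1 hy0 hD hf hfg (w₁ := t - x) (w₂ := 1 - y)
      (Or.inr (by linarith))
    simp only [zero_mul, add_zero]
    rw [← max_assoc 0 0, max_self, add_comm (a₂ * _), add_comm (b₂ * _)]
    exact max_le (le_max_left _ _) (max_le h (le_max_right _ _))

/-- The first item adds nothing on the right and top edges, and it can only raise the two edges that
are subtracted. -/
theorem revenueAt_le_of_corner (ha₁ : 0 ≤ a₁) (ha₂ : 0 ≤ a₂) (hx0 : 0 ≤ x) (hx1 : x ≤ 1)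
    (hy0 : 0 ≤ y) (hy1 : y ≤ 1) (hD : 0 ≤ a₁ * b₂ - a₂ * b₁)
    (hf : 0 < a₁ * (1 - x) - a₂ * y) (hfg : a₁ * (1 - x) - a₂ * y ≤ b₁ * (1 - x) - b₂ * y) :
    revenueAt x y a₁ a₂ b₁ b₂ ≤ revenueAt x y 0 0 b₁ b₂ := by
  obtain ⟨h1, h2⟩ := edges_le_of_corner ha₁ ha₂ hx1 hy0 hy1 hD hf hfg
  have h3 := edge_zero_left_le (-x) y a₁ a₂ b₁ b₂
  have h4 := edge_zero_left_le (-y) x a₂ a₁ b₂ b₁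
  unfold revenueAt
  gcongr

/-- With a tie at the corner, the first item is at least as good as the second along the whole
bottom edge, so ignoring the second one there costs nothing. -/
theorem revenueBound_le_of_corner (ha₁ : 0 ≤ a₁) (ha₂ : 0 ≤ a₂) (hx0 : 0 ≤ x) (hx1 : x ≤ 1)
    (hy0 : 0 ≤ y) (hy1 : y ≤ 1) (hD : 0 ≤ a₁ * b₂ - a₂ * b₁)
    (hf : 0 < a₁ * (1 - x) - a₂ * y) (hfg : a₁ * (1 - x) - a₂ * y = b₁ * (1 - x) - b₂ * y) :
    revenueBound x y a₁ a₂ b₁ b₂ ≤ revenueAt x y 0 0 b₁ b₂ := by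
  obtain ⟨h1, h2⟩ := edges_le_of_corner ha₁ ha₂ hx1 hy0 hy1 hD hf hfg.le
  have h4 : edge (-y) x 0 0 b₂ b₁ ≤ edge (-y) x a₂ a₁ 0 0 := by
    refine edge_le_edge fun t _ ht1 => ?_
    have key : (a₁ * (1 - x) - a₂ * y) *
        ((a₂ * -y + a₁ * (t - x)) - (b₂ * -y + b₁ * (t - x))) =
        (a₁ * b₂ - a₂ * b₁) * (y * (1 - t)) := by
      linear_combination (a₂ * -y + a₁ * (t - x)) * hfg
    have hnn : 0 ≤ (a₁ * b₂ - a₂ * b₁) * (y * (1 - t)) :=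
      mul_nonneg hD (mul_nonneg hy0 (by linarith))
    rw [← key] at hnn
    have := nonneg_of_mul_nonneg_right hnn hf
    simp only [zero_mul, add_zero]
    refine max_le (le_max_left _ _) (max_le (le_max_left _ _) ?_)
    exact le_trans (by linarith) ((le_max_left _ _).trans (le_max_right _ _))
  unfold revenueAt revenueBound
  gcongr

/-- On the bottom edge the second item is best at the corner, where it is still not attractive. -/
theorem revenueBound_zero (hb₁ : 0 ≤ b₁) (hg : b₁ * (1 - x) - b₂ * y ≤ 0) :
    revenueBound x y 0 0 b₁ b₂ = revenueAt x y 0 0 b₁ b₂ := by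
  have h : edge (-y) x 0 0 b₂ b₁ = edge (-y) x 0 0 0 0 := by
    refine le_antisymm (edge_le_edge fun t _ ht1 => ?_) (edge_zero_right_le _ _ _ _ _ _)
    simp only [zero_mul, add_zero, max_self]
    refine max_le le_rfl (max_le le_rfl ?_)
    nlinarith [mul_nonneg hb₁ (sub_nonneg.2 ht1)]
  rw [revenueBound, revenueAt, h]

end Corner

/-! ### Explicit bound for the items (1, α) and (β, 1) -/

section Integrals

variable {x y α β : ℝ}

theorem integral_piecewise_affine {y e : ℝ} (hy0 : 0 ≤ y) (hy1 : y ≤ 1) (he : 0 ≤ e)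
    (c k : ℝ) :
    ∫ t in (0 : ℝ)..1,
        (e + c * max 0 (y - t) + (1 - k) * max 0 (t - y) + k * max 0 (t - (y + e))) =
      e + c * (y ^ 2 / 2) + (1 - k) * ((1 - y) ^ 2 / 2) + k * ((max 0 (1 - y - e)) ^ 2 / 2) := by
  rw [intervalIntegral.integral_add (Continuous.intervalIntegrable (by fun_prop) _ _)
      (Continuous.intervalIntegrable (by fun_prop) _ _),
    intervalIntegral.integral_add (Continuous.intervalIntegrable (by fun_prop) _ _)
      (Continuous.intervalIntegrable (by fun_prop) _ _),
    intervalIntegral.integral_add (Continuous.intervalIntegrable (by fun_prop) _ _)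
      (Continuous.intervalIntegrable (by fun_prop) _ _),
    intervalIntegral.integral_const_mul, intervalIntegral.integral_const_mul,
    intervalIntegral.integral_const_mul, integral_pos_part_sub' hy0 hy1,
    integral_pos_part_sub hy0, integral_pos_part_sub (by linarith : 0 ≤ y + e),
    max_eq_right (by linarith : 0 ≤ 1 - y)]
  simp [sub_sub]

/-- Below height `y` the utility is at most e = 1 - x plus `α * (t - y)`, or zero, and this convex
function lies under its chord. Above `y`, both affine pieces lie under a function that starts at e
with slope 1 - k and steepens to slope 1 after a distance e, because k = (1 - α)(1 - β) is at most 1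
- α and at most 1 - β. The product form gives the right and top edges the same k. -/
theorem edge_right_le (hx1 : x ≤ 1) (hy0 : 0 ≤ y) (hy1 : y ≤ 1) (hα0 : 0 ≤ α)
    (hα1 : α ≤ 1) (hβ0 : 0 ≤ β) (hβ1 : β ≤ 1) :
    edge (1 - x) y 1 α β 1 ≤
      (1 - x) + (max 0 (1 - x - α * y) - (1 - x)) * y / 2 +
        (1 - (1 - α) * (1 - β)) * ((1 - y) ^ 2 / 2) +
        (1 - α) * (1 - β) * ((max 0 (x - y)) ^ 2 / 2) := by
  set e := 1 - x with he
  set w := max 0 (e - α * y) with hw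
  set k := (1 - α) * (1 - β) with hk
  have he0 : 0 ≤ e := by linarith
  have hw0 : 0 ≤ w := le_max_left _ _
  have hw1 : e - α * y ≤ w := le_max_right _ _
  have hA : 0 ≤ 1 - α := by linarith
  have hB : 0 ≤ 1 - β := by linarith
  have hk0 : 0 ≤ k := mul_nonneg hA hB
  have hkA : k ≤ 1 - α := mul_le_of_le_one_right hA (by linarith)
  have hkB : k ≤ 1 - β := mul_le_of_le_one_left hB (by linarith)
  -- The chord has slope `(e - w) / y`. For `y = 0` the quotient is zero by convention and its term
  -- vanishes.
  have hint := integral_piecewise_affine hy0 hy1 he0 ((w - e) / y) k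
  have h1 : (w - e) / y * (y ^ 2 / 2) = (w - e) * y / 2 := by
    rcases hy0.eq_or_lt with h | h
    · simp [← h]
    · field_simp
  have h2 : 1 - y - e = x - y := by rw [he]; ring
  rw [h1, h2] at hint
  rw [← hint]
  refine edge_le_integral (by fun_prop) fun t ht0 ht1 => ?_
  rcases le_or_gt t y with hty | hty
  · rw [max_eq_right (by linarith : 0 ≤ y - t), max_eq_left (by linarith : t - y ≤ 0),
      max_eq_left (by linarith : t - (y + e) ≤ 0)]
    have hval : e + (w - e) / y * (y - t) = (e * t + w * (y - t)) / y ∨ y = t := by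
      rcases hy0.eq_or_lt with h | h
      · right; linarith
      · left; field_simp; ring
    rcases hval with h | h
    · rcases hy0.eq_or_lt with h' | h'
      · have : t = 0 := by linarith
        subst this
        rw [← h']
        simp only [sub_self, mul_zero, add_zero, one_mul]
        exact max_le he0 (max_le le_rfl (by linarith [mul_le_mul_of_nonneg_right hβ1 he0]))
      rw [h]
      simp only [mul_zero, add_zero]
      rw [le_div_iff₀ h']
      have hty' : 0 ≤ y - t := by linarith
      have hmax : max (1 * e + α * (t - y)) (β * e + 1 * (t - y)) ≤ e + α * (t - y) := by
        refine max_le (by linarith) ?_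
        linarith [mul_nonneg hB he0, mul_nonneg hA hty']
      have : max 0 (max (1 * e + α * (t - y)) (β * e + 1 * (t - y))) ≤
          max 0 (e + α * (t - y)) := max_le_max le_rfl hmax
      refine (mul_le_mul_of_nonneg_right this hy0).trans ?_
      rcases le_total (e + α * (t - y)) 0 with h0 | h0
      · rw [max_eq_left h0, zero_mul]; positivity
      · rw [max_eq_right h0]
        linarith [mul_le_mul_of_nonneg_right hw1 hty']
    · subst h
      simp only [sub_self, mul_zero, add_zero, one_mul]
      exact max_le he0 (max_le le_rfl (by linarith [mul_le_mul_of_nonneg_right hβ1 he0]))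
  · rw [max_eq_left (by linarith : y - t ≤ 0), max_eq_right (by linarith : 0 ≤ t - y)]
    have hs : 0 < t - y := by linarith
    have m1 : 0 ≤ max 0 (t - (y + e)) := le_max_left _ _
    have m2 : t - (y + e) ≤ max 0 (t - (y + e)) := le_max_right _ _
    have m3 : 0 ≤ k * max 0 (t - (y + e)) := mul_nonneg hk0 m1
    have m4 := mul_le_mul_of_nonneg_left m2 hk0
    have n1 := mul_le_mul_of_nonneg_right hkA hs.le
    have n2 := mul_le_mul_of_nonneg_right hkB he0
    refine max_le ?_ (max_le ?_ ?_)
    · have : 0 ≤ (1 - k) * (t - y) := mul_nonneg (by linarith) hs.le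
      linarith
    · linarith
    · linarith

theorem edge_left_eq (hx0 : 0 ≤ x) (hy0 : 0 ≤ y) (hβ0 : 0 ≤ β) :
    edge (-x) y 0 0 β 1 = (max 0 (1 - y - β * x)) ^ 2 / 2 := by
  have h := integral_pos_part_sub (c := y + β * x) (by positivity)
  have e : ∀ t : ℝ, max 0 (max (0 * -x + 0 * (t - y)) (β * -x + 1 * (t - y))) =
      max 0 (t - (y + β * x)) := by
    intro t
    rw [zero_mul, zero_mul, add_zero, ← max_assoc, max_self]
    ring_nf
  rw [edge]
  simp only [e]
  rw [h, sub_sub]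

theorem revenueBound_le (hx0 : 0 ≤ x) (hx1 : x ≤ 1) (hy0 : 0 ≤ y) (hy1 : y ≤ 1) (hα0 : 0 ≤ α)
    (hα1 : α ≤ 1) (hβ0 : 0 ≤ β) (hβ1 : β ≤ 1) :
    revenueBound x y 1 α β 1 ≤
      x * ((1 - x) + (max 0 (1 - x - α * y) - (1 - x)) * y / 2 +
        (1 - (1 - α) * (1 - β)) * ((1 - y) ^ 2 / 2) +
        (1 - α) * (1 - β) * ((max 0 (x - y)) ^ 2 / 2) - (max 0 (1 - y - β * x)) ^ 2 / 2) +
      y * ((1 - y) + (max 0 (1 - y - β * x) - (1 - y)) * x / 2 +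
        (1 - (1 - α) * (1 - β)) * ((1 - x) ^ 2 / 2) +
        (1 - α) * (1 - β) * ((max 0 (y - x)) ^ 2 / 2) - (max 0 (1 - x - α * y)) ^ 2 / 2) := by
  have h1 := edge_right_le (x := x) (y := y) hx1 hy0 hy1 hα0 hα1 hβ0 hβ1
  have h2 := edge_right_le (x := y) (y := x) hy1 hx0 hx1 hβ0 hβ1 hα0 hα1
  rw [edge_comm, mul_comm (1 - β)] at h2
  have h3 := edge_left_eq (x := x) (y := y) hx0 hy0 hβ0
  have h4 := edge_left_eq (x := y) (y := x) hy0 hx0 hα0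
  rw [edge_comm] at h4
  rw [revenueBound, h3, h4]
  gcongr

end Integrals

/-! ### The polynomial inequality -/

theorem mul_max_le_of_sq_eq {X Y η : ℝ} (hη : 0 < η)
    (hη2 : η ^ 2 = (X ^ 2 + Y ^ 2 - 2 / 3) ^ 3 + 2 * (X ^ 2 + Y ^ 2 - 5 / 6) ^ 2) :
    Y * max 0 (3 / 2 * X ^ 2 + Y ^ 2 - 1) ≤ η ∧
      (Y * max 0 (3 / 2 * X ^ 2 + Y ^ 2 - 1) = η → X ^ 2 = 2 / 3 ∧ Y ^ 2 = 1 / 6) := by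
  rcases le_or_gt (3 / 2 * X ^ 2 + Y ^ 2 - 1) 0 with h | h
  · rw [max_eq_left h, mul_zero]
    exact ⟨hη.le, fun h' => absurd h' hη.ne⟩
  · rw [max_eq_right h.le]
    obtain ⟨W, hW⟩ : ∃ W, W = 3 / 2 * X ^ 2 + Y ^ 2 - 1 := ⟨_, rfl⟩
    rw [← hW] at h ⊢
    -- Both terms are nonnegative, and both vanish only if x + y = 5/6 and W = y, that is, at x =
    -- 2/3, y = 1/6.
    have key : η ^ 2 - (Y * W) ^ 2 =
        2 * (X ^ 2 + Y ^ 2 - 5 / 6) ^ 2 + (Y ^ 2 - W) ^ 2 * (Y ^ 2 + 8 * W) / 27 := by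
      have hX : X ^ 2 = 2 / 3 * (W - Y ^ 2 + 1) := by rw [hW]; ring
      rw [hη2, hX]; ring
    have n1 : 0 ≤ (X ^ 2 + Y ^ 2 - 5 / 6) ^ 2 := sq_nonneg _
    have n2 : 0 ≤ (Y ^ 2 - W) ^ 2 * (Y ^ 2 + 8 * W) := by positivity
    refine ⟨abs_le_of_sq_le_sq' (by linarith) hη.le |>.2, fun he => ?_⟩
    rw [he, sub_self] at key
    have z1 : (X ^ 2 + Y ^ 2 - 5 / 6) ^ 2 = 0 := by linarith
    have z2 : (Y ^ 2 - W) ^ 2 * (Y ^ 2 + 8 * W) = 0 := by linarith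
    have z3 : X ^ 2 + Y ^ 2 - 5 / 6 = 0 := pow_eq_zero_iff two_ne_zero |>.1 z1
    have z4 : Y ^ 2 - W = 0 := by
      rcases mul_eq_zero.1 z2 with h' | h'
      · exact pow_eq_zero_iff two_ne_zero |>.1 h'
      · nlinarith [sq_nonneg Y]
    constructor <;> linarith

/-- At the optimal point the positive part attached to `B` vanishes, so `h1` kills `B`; the
vanishing square `h2` then fixes `A`. -/
theorem weights_of_optimal {X Y A B η : ℝ} (hY : 0 ≤ Y) (hY2 : Y ^ 2 = 1 / 6)
    (hX2 : X ^ 2 = 2 / 3) (hη : 0 < η) (hopt : Y * max 0 (3 / 2 * X ^ 2 + Y ^ 2 - 1) = η)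
    (h1 : B * X ^ 3 * (η - X * max 0 (3 / 2 * Y ^ 2 + X ^ 2 - 1)) = 0)
    (h2 : η = A * Y ^ 3 + B * X ^ 3) : A = 1 ∧ B = 0 := by
  rw [max_eq_left (by rw [hX2, hY2]; norm_num), mul_zero, sub_zero] at h1
  have hB : B * X ^ 3 = 0 := by
    rcases mul_eq_zero.1 h1 with h | h
    · exact h
    · exact absurd h hη.ne'
  have hX3 : X ^ 3 ≠ 0 := by
    intro h
    have : X = 0 := pow_eq_zero_iff three_ne_zero |>.1 h
    rw [this] at hX2; norm_num at hX2
  have hY0 : 0 < Y := by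
    rcases hY.eq_or_lt with h | h
    · rw [← h] at hY2; norm_num at hY2
    · exact h
  refine ⟨?_, (mul_eq_zero.1 hB).resolve_right hX3⟩
  have hW : max 0 (3 / 2 * X ^ 2 + Y ^ 2 - 1) = Y ^ 2 := by
    rw [hX2, hY2]; norm_num
  rw [hW] at hopt
  have hY3 : 0 < Y ^ 3 := by positivity
  refine mul_right_cancel₀ hY3.ne' ?_
  rw [hB] at h2
  linarith [hopt, h2, (by ring : Y * Y ^ 2 = Y ^ 3)]

/-- The polynomial inequality behind the optimality of the two asymmetric menus, in the variables
`X = √x` and `Y = √y`. -/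
theorem polynomial_bound {X Y A B η : ℝ} (hX : 0 ≤ X) (hY : 0 ≤ Y) (hA0 : 0 ≤ A)
    (hB0 : 0 ≤ B) (hη : 0 < η)
    (hη2 : η ^ 2 = (X ^ 2 + Y ^ 2 - 2 / 3) ^ 3 + 2 * (X ^ 2 + Y ^ 2 - 5 / 6) ^ 2) :
    A * (Y ^ 4 * (3 / 2 * X ^ 2 + Y ^ 2 - 1)) + B * (X ^ 4 * (3 / 2 * Y ^ 2 + X ^ 2 - 1)) ≤
        η ^ 2 / 2 + A ^ 2 * Y ^ 6 / 2 + B ^ 2 * X ^ 6 / 2 + A * B * X ^ 3 * Y ^ 3 ∧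
    (A * (Y ^ 4 * (3 / 2 * X ^ 2 + Y ^ 2 - 1)) + B * (X ^ 4 * (3 / 2 * Y ^ 2 + X ^ 2 - 1)) =
        η ^ 2 / 2 + A ^ 2 * Y ^ 6 / 2 + B ^ 2 * X ^ 6 / 2 + A * B * X ^ 3 * Y ^ 3 →
      X ^ 2 = 2 / 3 ∧ Y ^ 2 = 1 / 6 ∧ A = 1 ∧ B = 0 ∨
      X ^ 2 = 1 / 6 ∧ Y ^ 2 = 2 / 3 ∧ A = 0 ∧ B = 1) := by
  obtain ⟨p1, p2⟩ := mul_max_le_of_sq_eq hη hη2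
  obtain ⟨q1, q2⟩ := mul_max_le_of_sq_eq (X := Y) (Y := X) hη (by rw [hη2]; ring)
  set W := 3 / 2 * X ^ 2 + Y ^ 2 - 1 with hW
  set V := 3 / 2 * Y ^ 2 + X ^ 2 - 1 with hV
  have hAY : 0 ≤ A * Y ^ 3 := by positivity
  have hBX : 0 ≤ B * X ^ 3 := by positivity
  have w1 : A * (Y ^ 4 * W) ≤ A * Y ^ 3 * (Y * max 0 W) := by
    have := mul_le_mul_of_nonneg_left (le_max_right 0 W) (by positivity : 0 ≤ A * Y ^ 4)
    linarith
  have v1 : B * (X ^ 4 * V) ≤ B * X ^ 3 * (X * max 0 V) := by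
    have := mul_le_mul_of_nonneg_left (le_max_right 0 V) (by positivity : 0 ≤ B * X ^ 4)
    linarith
  have a1 := mul_nonneg hAY (sub_nonneg.2 p1)
  have a2 := mul_nonneg hBX (sub_nonneg.2 q1)
  have a3 := sq_nonneg (η - A * Y ^ 3 - B * X ^ 3)
  -- Completing the square in η leaves only terms linear in `A` and `B`, and for these the
  -- comparison of `Y * max 0 W` and `X * max 0 V` with η suffices.
  have expand : η ^ 2 / 2 + A ^ 2 * Y ^ 6 / 2 + B ^ 2 * X ^ 6 / 2 + A * B * X ^ 3 * Y ^ 3 =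
      (η - A * Y ^ 3 - B * X ^ 3) ^ 2 / 2 + A * Y ^ 3 * η + B * X ^ 3 * η := by ring
  rw [expand]
  refine ⟨by linarith, fun he => ?_⟩
  have z1 : A * Y ^ 3 * (η - Y * max 0 W) = 0 := by linarith
  have z2 : B * X ^ 3 * (η - X * max 0 V) = 0 := by linarith
  have z3 : (η - A * Y ^ 3 - B * X ^ 3) ^ 2 = 0 := by linarith
  have z4 : η - A * Y ^ 3 - B * X ^ 3 = 0 := pow_eq_zero_iff two_ne_zero |>.1 z3
  rcases mul_eq_zero.1 z1 with hz | hz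
  · rcases mul_eq_zero.1 z2 with hz' | hz'
    -- If both weighted terms vanished, the square would give η = 0.
    · linarith
    · obtain ⟨r1, r2⟩ := q2 (by linarith)
      obtain ⟨s1, s2⟩ := weights_of_optimal (A := B) (B := A) hX r2 r1 hη (by linarith) z1 (by linarith)
      exact Or.inr ⟨r2, r1, s2, s1⟩
  · obtain ⟨r1, r2⟩ := p2 (by linarith)
    obtain ⟨s1, s2⟩ := weights_of_optimal (A := A) (B := B) hY r2 r1 hη (by linarith) z2 (by linarith)
    exact Or.inl ⟨r1, r2, s1, s2⟩

/-- The terms with (1 - α)(1 - β) only lower the bound, and maximizing freely over `w` and `w'`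
removes α and β. With xy ≤ (x + y)²/4 there remains a cubic in x + y, at most its value 17/32 at x +
y = 1. -/
theorem revenueBound_le_of_one_le_add {x y α β : ℝ} (hx0 : 0 ≤ x) (hx1 : x ≤ 1) (hy0 : 0 ≤ y)
    (hy1 : y ≤ 1) (hα0 : 0 ≤ α) (hα1 : α ≤ 1) (hβ0 : 0 ≤ β) (hβ1 : β ≤ 1) (hxy : 1 ≤ x + y) :
    revenueBound x y 1 α β 1 < 59 / 108 := by
  refine (revenueBound_le hx0 hx1 hy0 hy1 hα0 hα1 hβ0 hβ1).trans_lt ?_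
  set w := max 0 (1 - x - α * y)
  set w' := max 0 (1 - y - β * x)
  have hk : 0 ≤ (1 - α) * (1 - β) := mul_nonneg (by linarith) (by linarith)
  have hsq : ∀ u v : ℝ, 0 ≤ u → 0 ≤ v → u ≤ 1 → (max 0 (u - v)) ^ 2 ≤ (1 - v) ^ 2 ∨ 1 < v := by
    intro u v _ hv hu
    rcases le_or_gt v 1 with h | h
    · left
      refine pow_le_pow_left₀ (le_max_left _ _) (max_le (by linarith) (by linarith)) 2
    · right; exact h
  have m1 := (hsq x y hx0 hy0 hx1).resolve_right (not_lt.2 hy1)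
  have m2 := (hsq y x hy0 hx0 hy1).resolve_right (not_lt.2 hx1)
  have k1 := mul_nonneg hx0 (mul_nonneg hk (sub_nonneg.2 m1))
  have k2 := mul_nonneg hy0 (mul_nonneg hk (sub_nonneg.2 m2))
  have q1 : y * (x * w / 2 - w ^ 2 / 2) ≤ y * (x ^ 2 / 8) :=
    mul_le_mul_of_nonneg_left (by linarith [sq_nonneg (w - x / 2)]) hy0
  have q2 : x * (y * w' / 2 - w' ^ 2 / 2) ≤ x * (y ^ 2 / 8) :=
    mul_le_mul_of_nonneg_left (by linarith [sq_nonneg (w' - y / 2)]) hx0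
  have hπ : x * y * (9 * (x + y) / 8 - 1) ≤ (x + y) ^ 2 / 4 * (9 * (x + y) / 8 - 1) :=
    mul_le_mul_of_nonneg_right (by linarith [sq_nonneg (x - y)]) (by linarith)
  have hs : 0 ≤ (x + y - 1) * (2 - (x + y)) := mul_nonneg (by linarith) (by linarith)
  have hfin : 3 / 2 * (x + y) - (x + y) ^ 2 + (x + y) ^ 2 / 4 * (9 * (x + y) / 8 - 1) ≤
      17 / 32 := by
    linarith [mul_nonneg hs (by linarith : 0 ≤ x + y - 1),
      mul_nonneg (by linarith : 0 ≤ x + y) (by linarith : 0 ≤ x + y - 1)]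
  linarith only [k1, k2, q1, q2, hπ, hfin]

/-- The expression is s³ - 2s + 59/54. For s ≤ 1 this is twice the gap between 59/108 and the
revenue s - s³/2 of the bundle at price s. 1633/2000 approximates the minimizer √(2/3). -/
theorem slack_pos {s : ℝ} (hs : 0 ≤ s) : 0 < (s - 2 / 3) ^ 3 + 2 * (s - 5 / 6) ^ 2 := by
  linarith only [mul_nonneg (sq_nonneg (s - 1633 / 2000)) (by linarith : 0 ≤ s + 1633 / 1000), hs]

/-- The right side is -2 times the coefficient of AB in the explicit bound; it has to dominate the
cross term of the completed square. -/
theorem mul_mul_add_le {x y : ℝ} (hx0 : 0 ≤ x) (hy0 : 0 ≤ y) (hxy : x + y ≤ 1) :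
    x * y * (x + y) ≤ x * ((1 - y) ^ 2 - (max 0 (x - y)) ^ 2) +
      y * ((1 - x) ^ 2 - (max 0 (y - x)) ^ 2) := by
  have f1 := mul_le_mul_of_nonneg_left (pow_le_pow_left₀ hx0 (by linarith : x ≤ 1 - y) 2) hx0
  have f2 := mul_le_mul_of_nonneg_left (pow_le_pow_left₀ hy0 (by linarith : y ≤ 1 - x) 2) hy0
  have g1 := mul_nonneg hx0 (sq_nonneg (x - y))
  have g2 := mul_nonneg hy0 (sq_nonneg (x - y))
  rcases le_total x y with hle | hle
  · rw [max_eq_left (by linarith : x - y ≤ 0), max_eq_right (by linarith)]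
    linarith
  · rw [max_eq_left (by linarith : y - x ≤ 0), max_eq_right (by linarith)]
    linarith

theorem revenueBound_le_of_add_le_one {x y α β : ℝ} (hx0 : 0 ≤ x) (hx1 : x ≤ 1) (hy0 : 0 ≤ y)
    (hy1 : y ≤ 1) (hα0 : 0 ≤ α) (hα1 : α ≤ 1) (hβ0 : 0 ≤ β) (hβ1 : β ≤ 1) (hxy : x + y ≤ 1) :
    revenueBound x y 1 α β 1 ≤ 59 / 108 ∧
    (revenueBound x y 1 α β 1 = 59 / 108 →
      x = 2 / 3 ∧ y = 1 / 6 ∧ α = 0 ∧ β = 1 ∨ x = 1 / 6 ∧ y = 2 / 3 ∧ α = 1 ∧ β = 0) := by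
  have h := revenueBound_le hx0 hx1 hy0 hy1 hα0 hα1 hβ0 hβ1
  obtain ⟨A, hA⟩ : ∃ A, A = 1 - α := ⟨_, rfl⟩
  obtain ⟨B, hB⟩ : ∃ B, B = 1 - β := ⟨_, rfl⟩
  have hA0 : 0 ≤ A := by linarith
  have hB0 : 0 ≤ B := by linarith
  rw [max_eq_right (by linarith [mul_le_mul_of_nonneg_right hα1 hy0] : 0 ≤ 1 - x - α * y),
    max_eq_right (by linarith [mul_le_mul_of_nonneg_right hβ1 hx0] : 0 ≤ 1 - y - β * x)] at h
  -- Square roots make the weights x^(3/2) and y^(3/2) of the completed square polynomial.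
  obtain ⟨X, hX, rfl⟩ : ∃ X, 0 ≤ X ∧ x = X ^ 2 := ⟨√x, Real.sqrt_nonneg _, (Real.sq_sqrt hx0).symm⟩
  obtain ⟨Y, hY, rfl⟩ : ∃ Y, 0 ≤ Y ∧ y = Y ^ 2 := ⟨√y, Real.sqrt_nonneg _, (Real.sq_sqrt hy0).symm⟩
  have hpos := slack_pos (by positivity : 0 ≤ X ^ 2 + Y ^ 2)
  obtain ⟨η, hη, hη2⟩ : ∃ η, 0 < η ∧
      η ^ 2 = (X ^ 2 + Y ^ 2 - 2 / 3) ^ 3 + 2 * (X ^ 2 + Y ^ 2 - 5 / 6) ^ 2 :=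
    ⟨√_, Real.sqrt_pos.2 hpos, Real.sq_sqrt hpos.le⟩
  obtain ⟨p1, p2⟩ := polynomial_bound hX hY hA0 hB0 hη hη2
  have hΔ := mul_mul_add_le hx0 hy0 hxy
  have hXY : 2 * (X ^ 3 * Y ^ 3) ≤ X ^ 2 * Y ^ 2 * (X ^ 2 + Y ^ 2) := by
    linarith only [mul_nonneg (by positivity : 0 ≤ X ^ 2 * Y ^ 2) (sq_nonneg (X - Y))]
  have hAB := mul_le_mul_of_nonneg_left (hXY.trans hΔ) (mul_nonneg hA0 hB0)
  obtain ⟨rfl, rfl⟩ : α = 1 - A ∧ β = 1 - B := ⟨by linarith, by linarith⟩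
  -- For A = B = 0 this is the revenue of the bundle at price x + y.
  have h' := h.trans_eq (b := _) (c := 59 / 108 - η ^ 2 / 2 +
    (A * (Y ^ 4 * (3 / 2 * X ^ 2 + Y ^ 2 - 1)) + B * (X ^ 4 * (3 / 2 * Y ^ 2 + X ^ 2 - 1))) -
    A ^ 2 * Y ^ 6 / 2 - B ^ 2 * X ^ 6 / 2 -
    A * B * (X ^ 2 * ((1 - Y ^ 2) ^ 2 - (max 0 (X ^ 2 - Y ^ 2)) ^ 2) +
        Y ^ 2 * ((1 - X ^ 2) ^ 2 - (max 0 (Y ^ 2 - X ^ 2)) ^ 2)) / 2) (by rw [hη2]; ring)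
  clear h
  constructor
  · linarith only [h', p1, hAB]
  · intro he
    have := p2 (le_antisymm p1 (by linarith only [h', he, hAB]))
    rcases this with ⟨r1, r2, r3, r4⟩ | ⟨r1, r2, r3, r4⟩
    · left; exact ⟨r1, r2, by linarith, by linarith⟩
    · right; exact ⟨r1, r2, by linarith, by linarith⟩

/-- The revenue bound for two items each of which allocates one good with certainty. -/
theorem revenueBound_le_of_one_one {x y α β : ℝ} (hx0 : 0 ≤ x) (hx1 : x ≤ 1) (hy0 : 0 ≤ y)
    (hy1 : y ≤ 1) (hα0 : 0 ≤ α) (hα1 : α ≤ 1) (hβ0 : 0 ≤ β) (hβ1 : β ≤ 1) :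
    revenueBound x y 1 α β 1 ≤ 59 / 108 ∧
    (revenueBound x y 1 α β 1 = 59 / 108 →
      x = 2 / 3 ∧ y = 1 / 6 ∧ α = 0 ∧ β = 1 ∨ x = 1 / 6 ∧ y = 2 / 3 ∧ α = 1 ∧ β = 0) := by
  rcases le_total (x + y) 1 with h | h
  · exact revenueBound_le_of_add_le_one hx0 hx1 hy0 hy1 hα0 hα1 hβ0 hβ1 h
  · have := revenueBound_le_of_one_le_add hx0 hx1 hy0 hy1 hα0 hα1 hβ0 hβ1 h
    exact ⟨this.le, fun h' => absurd h' this.ne⟩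

/-- When β is raised to 1 with the common zero kept, the right edge gains at least what the left
edge loses, and the bottom edge of the bound ignores the second item. The gain on the top edge is
recorded for the equality case. -/
theorem revenueBound_mono {x y α β : ℝ} (hx0 : 0 ≤ x) (hx1 : x ≤ 1) (hy0 : 0 ≤ y)
    (hy1 : y ≤ 1) (hαβ : α ≤ β) (hβ0 : 0 ≤ β) (hβ1 : β ≤ 1) :
    revenueBound x y 1 α 1 β + y * ((1 - β) * (1 - y) * ((1 - x) ^ 2 / 2)) ≤
      revenueBound x y 1 α 1 1 := by
  have hB : 0 ≤ 1 - β := by linarith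
  have hd : 0 ≤ 1 - y := by linarith
  have h1 : edge (1 - x) y 1 α 1 β + edge (-x) y 0 0 1 1 ≤
      edge (1 - x) y 1 α 1 1 + edge (-x) y 0 0 1 β := by
    unfold edge
    rw [← intervalIntegral.integral_add (Continuous.intervalIntegrable (by fun_prop) _ _)
      (Continuous.intervalIntegrable (by fun_prop) _ _),
      ← intervalIntegral.integral_add (Continuous.intervalIntegrable (by fun_prop) _ _)
      (Continuous.intervalIntegrable (by fun_prop) _ _)]
    refine intervalIntegral.integral_mono_on zero_le_one
      (Continuous.intervalIntegrable (by fun_prop) _ _)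
      (Continuous.intervalIntegrable (by fun_prop) _ _) fun t ht => ?_
    simp only [one_mul, zero_mul, add_zero]
    rw [← max_assoc 0 0, max_self, ← max_assoc 0 0, max_self]
    rcases le_total t y with h | h
    · have hs : 0 ≤ y - t := by linarith
      have e1 := mul_nonneg (sub_nonneg.2 hαβ) hs
      have e2 := mul_nonneg (sub_nonneg.2 (hαβ.trans hβ1)) hs
      rw [max_eq_left (by linarith : 1 - x + β * (t - y) ≤ 1 - x + α * (t - y)),
        max_eq_left (by linarith : 1 - x + (t - y) ≤ 1 - x + α * (t - y)),
        max_eq_left (by linarith : -x + (t - y) ≤ 0)]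
      linarith [le_max_left 0 (-x + β * (t - y))]
    · have hs : 0 ≤ t - y := by linarith
      have e1 := mul_nonneg (sub_nonneg.2 hαβ) hs
      have e2 := mul_nonneg hB hs
      have m1 : max 0 (max (1 - x + α * (t - y)) (1 - x + β * (t - y))) ≤
          max 0 (1 - x + β * (t - y)) := max_le_max le_rfl (max_le (by linarith) le_rfl)
      have m2 : 1 - x + (t - y) ≤ max 0 (max (1 - x + α * (t - y)) (1 - x + (t - y))) :=
        (le_max_right _ _).trans (le_max_right _ _)
      have m3 : 0 ≤ max 0 (-x + β * (t - y)) := le_max_left _ _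
      have m4 : -x + β * (t - y) ≤ max 0 (-x + β * (t - y)) := le_max_right _ _
      have m5 : max 0 (1 - x + β * (t - y)) + max 0 (-x + (t - y)) ≤
          1 - x + (t - y) + max 0 (-x + β * (t - y)) := by
        rcases le_total (-x + (t - y)) 0 with g | g
        · rw [max_eq_left g, add_zero]
          exact max_le (by linarith) (by linarith)
        · rw [max_eq_right g, ← le_sub_iff_add_le]
          exact max_le (by linarith) (by linarith)
      linarith
  have h2 : edge (1 - y) x α 1 β 1 + (1 - β) * (1 - y) * ((1 - x) ^ 2 / 2) ≤
      edge (1 - y) x α 1 1 1 := by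
    have hint := integral_pos_part_sub hx0
    rw [max_eq_right (by linarith : 0 ≤ 1 - x)] at hint
    unfold edge
    rw [← hint, ← intervalIntegral.integral_const_mul,
      ← intervalIntegral.integral_add (Continuous.intervalIntegrable (by fun_prop) _ _)
      (Continuous.intervalIntegrable (by fun_prop) _ _)]
    refine intervalIntegral.integral_mono_on zero_le_one
      (Continuous.intervalIntegrable (by fun_prop) _ _)
      (Continuous.intervalIntegrable (by fun_prop) _ _) fun t ht => ?_
    have e1 := mul_nonneg (sub_nonneg.2 hαβ) hd
    have e2 := mul_nonneg hB hd
    rw [max_eq_right (by linarith : α * (1 - y) + 1 * (t - x) ≤ β * (1 - y) + 1 * (t - x)),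
      max_eq_right (by linarith : α * (1 - y) + 1 * (t - x) ≤ 1 * (1 - y) + 1 * (t - x))]
    rcases le_total t x with h | h
    · rw [max_eq_left (by linarith : t - x ≤ 0), mul_zero, add_zero]
      exact max_le_max le_rfl (by linarith)
    · rw [max_eq_right (by linarith : 0 ≤ t - x), ← le_sub_iff_add_le]
      have e3 := mul_nonneg e2 (by linarith [ht.2] : 0 ≤ 1 - (t - x))
      have m1 := le_max_right 0 (1 * (1 - y) + 1 * (t - x))
      have e4 : (1 - β) * (1 - y) ≤ 1 - y := mul_le_of_le_one_left hd (by linarith)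
      exact max_le (by linarith) (by linarith)
  have h1' := mul_le_mul_of_nonneg_left h1 hx0
  have h2' := mul_le_mul_of_nonneg_left h2 hy0
  unfold revenueBound
  linarith

/-! ### Reduction to normalized items -/

/-- The parameters of the two optimal menus. -/
def IsOptimalParam (x y a₁ a₂ b₁ b₂ : ℝ) : Prop :=
  (x = 2 / 3 ∧ y = 1 / 6 ∧ a₁ = 1 ∧ a₂ = 0 ∧ b₁ = 1 ∧ b₂ = 1) ∨
    (x = 1 / 6 ∧ y = 2 / 3 ∧ a₁ = 1 ∧ a₂ = 1 ∧ b₁ = 0 ∧ b₂ = 1)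

theorem IsOptimalParam.mirror {x y a₁ a₂ b₁ b₂ : ℝ} (h : IsOptimalParam y x b₂ b₁ a₂ a₁) :
    IsOptimalParam x y a₁ a₂ b₁ b₂ := by
  unfold IsOptimalParam at *
  tauto

section

variable {x y a₁ a₂ b₁ b₂ : ℝ}

theorem revenueBound_le_of_fst_fst (hx0 : 0 ≤ x) (hx1 : x ≤ 1) (hy0 : 0 ≤ y) (hy1 : y ≤ 1)
    {α β : ℝ} (hα0 : 0 ≤ α) (hαβ : α ≤ β) (hβ1 : β ≤ 1) :
    revenueBound x y 1 α 1 β ≤ 59 / 108 ∧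
      (revenueBound x y 1 α 1 β = 59 / 108 → IsOptimalParam x y 1 α 1 β) := by
  have hm := revenueBound_mono hx0 hx1 hy0 hy1 hαβ (hα0.trans hαβ) hβ1
  obtain ⟨h1, h2⟩ := revenueBound_le_of_one_one hx0 hx1 hy0 hy1 hα0 (hαβ.trans hβ1) zero_le_one
    le_rfl
  have hB : 0 ≤ 1 - β := by linarith
  have hd : 0 ≤ 1 - y := by linarith
  have hgain : 0 ≤ y * ((1 - β) * (1 - y) * ((1 - x) ^ 2 / 2)) := by positivity
  refine ⟨by linarith, fun he => ?_⟩
  rcases h2 (le_antisymm h1 (by linarith)) with ⟨rfl, rfl, rfl, -⟩ | ⟨-, -, -, h⟩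
  · left
    -- At this point the recorded gain is a positive multiple of 1 - β, so equality forces β = 1.
    norm_num at hm h1
    refine ⟨rfl, rfl, rfl, rfl, rfl, by linarith⟩
  · norm_num at h

theorem revenueBound_le_of_normalized (hx0 : 0 ≤ x) (hx1 : x ≤ 1) (hy0 : 0 ≤ y) (hy1 : y ≤ 1)
    (ha₁ : a₁ ∈ Icc (0 : ℝ) 1) (ha₂ : a₂ ∈ Icc (0 : ℝ) 1) (hb₁ : b₁ ∈ Icc (0 : ℝ) 1)
    (hb₂ : b₂ ∈ Icc (0 : ℝ) 1) (hD : 0 < a₁ * b₂ - a₂ * b₁) (ha : a₁ = 1 ∨ a₂ = 1)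
    (hb : b₁ = 1 ∨ b₂ = 1) :
    revenueBound x y a₁ a₂ b₁ b₂ ≤ 59 / 108 ∧
      (revenueBound x y a₁ a₂ b₁ b₂ = 59 / 108 → IsOptimalParam x y a₁ a₂ b₁ b₂) := by
  rcases ha with rfl | rfl <;> rcases hb with rfl | rfl
  · exact revenueBound_le_of_fst_fst hx0 hx1 hy0 hy1 ha₂.1 (by linarith) hb₂.2
  · obtain ⟨h1, h2⟩ := revenueBound_le_of_one_one hx0 hx1 hy0 hy1 ha₂.1 ha₂.2 hb₁.1 hb₁.2
    refine ⟨h1, fun he => ?_⟩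
    rcases h2 he with ⟨r1, r2, r3, r4⟩ | ⟨r1, r2, r3, r4⟩
    · exact Or.inl ⟨r1, r2, rfl, r3, r4, rfl⟩
    · exact Or.inr ⟨r1, r2, rfl, r3, r4, rfl⟩
  · exfalso
    nlinarith [ha₁.1, ha₁.2, hb₂.1, hb₂.2]
  · rw [← revenueBound_mirror]
    obtain ⟨h1, h2⟩ := revenueBound_le_of_fst_fst hy0 hy1 hx0 hx1 hb₁.1
      (by linarith : b₁ ≤ a₁) ha₁.2
    exact ⟨h1, fun he => (h2 he).mirror⟩

theorem revenueAt_le_of_second_normalized (hx0 : 0 ≤ x) (hx1 : x ≤ 1) (hy0 : 0 ≤ y)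
    (hy1 : y ≤ 1) (ha₁ : a₁ ∈ Icc (0 : ℝ) 1) (ha₂ : a₂ ∈ Icc (0 : ℝ) 1)
    (hb₁ : b₁ ∈ Icc (0 : ℝ) 1) (hb₂ : b₂ ∈ Icc (0 : ℝ) 1) (hD : 0 < a₁ * b₂ - a₂ * b₁)
    (hb : b₁ = 1 ∨ b₂ = 1) :
    revenueAt x y a₁ a₂ b₁ b₂ ≤ 59 / 108 ∧
      (revenueAt x y a₁ a₂ b₁ b₂ = 59 / 108 → IsOptimalParam x y a₁ a₂ b₁ b₂) := by
  have hsingle := revenueAt_zero_le hx0 hy0 hb₁ hb₂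
  have hx1' : 0 ≤ 1 - x := by linarith
  by_cases hC : 0 < a₁ * (1 - x) - a₂ * y ∧ a₁ * (1 - x) - a₂ * y ≤ b₁ * (1 - x) - b₂ * y
  · have := revenueAt_le_of_corner ha₁.1 ha₂.1 hx0 hx1 hy0 hy1 hD.le hC.1 hC.2
    exact ⟨by linarith, fun h => by linarith⟩
  have hle := revenueAt_le_revenueBound hx0 hy0 a₁ a₂ b₁ b₂
  -- a smaller first item which is useless
  obtain ⟨r, hr0, hr1, hr⟩ : ∃ r : ℝ, 0 ≤ r ∧ r < 1 ∧
      revenueBound x y (r * a₁) (r * a₂) b₁ b₂ ≤ 109 / 200 := by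
    rcases le_or_gt (b₁ * (1 - x) - b₂ * y) 0 with hg | hg
    · refine ⟨0, le_rfl, one_pos, ?_⟩
      rw [zero_mul, zero_mul, revenueBound_zero hb₁.1 hg]
      exact hsingle
    · have hb₂0 : 0 < b₂ := by
        rcases hb₂.1.eq_or_lt with h | h
        · rw [← h] at hD
          nlinarith [mul_nonneg ha₂.1 hb₁.1]
        · exact h
      have hf : 0 < a₁ * (1 - x) - a₂ * y := by
        refine (mul_pos_iff_of_pos_right hb₂0).1 ?_
        have ha : 0 ≤ a₂ * (b₁ * (1 - x) - b₂ * y) := mul_nonneg ha₂.1 hg.le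
        have hx' : 0 < 1 - x := by
          rcases hx1'.eq_or_lt with h | h
          · rw [← h] at hg
            nlinarith [mul_nonneg hb₂.1 hy0]
          · exact h
        nlinarith [mul_pos hD hx']
      have hlt : b₁ * (1 - x) - b₂ * y < a₁ * (1 - x) - a₂ * y := by
        by_contra h
        exact hC ⟨hf, not_lt.1 h⟩
      -- At this scale the two items tie at the bottom right corner.
      set r := (b₁ * (1 - x) - b₂ * y) / (a₁ * (1 - x) - a₂ * y) with hr
      have hr0 : 0 < r := div_pos hg hf
      have hre : r * a₁ * (1 - x) - r * a₂ * y = b₁ * (1 - x) - b₂ * y := by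
        have := div_mul_cancel₀ (b₁ * (1 - x) - b₂ * y) hf.ne'
        rw [← hr] at this
        linarith
      refine ⟨r, hr0.le, (div_lt_one hf).2 hlt, le_trans ?_ hsingle⟩
      refine revenueBound_le_of_corner (mul_nonneg hr0.le ha₁.1) (mul_nonneg hr0.le ha₂.1)
        hx0 hx1 hy0 hy1 ?_ (by linarith) hre
      have := mul_nonneg hr0.le hD.le
      linarith
  -- a larger first item that allocates one good with certainty
  have hm0 : 0 < max a₁ a₂ := by
    by_contra h
    have h1 : a₁ ≤ 0 := (le_max_left _ _).trans (not_lt.1 h)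
    have h2 : a₂ ≤ 0 := (le_max_right _ _).trans (not_lt.1 h)
    have h1' : a₁ = 0 := le_antisymm h1 ha₁.1
    have h2' : a₂ = 0 := le_antisymm h2 ha₂.1
    rw [h1', h2'] at hD
    simp at hD
  have hm1 : max a₁ a₂ ≤ 1 := max_le ha₁.2 ha₂.2
  obtain ⟨s, hs⟩ : ∃ s, s = (max a₁ a₂)⁻¹ := ⟨_, rfl⟩
  have hs1 : 1 ≤ s := by rw [hs]; exact (one_le_inv₀ hm0).2 hm1
  have hsm : s * max a₁ a₂ = 1 := by rw [hs]; exact inv_mul_cancel₀ hm0.ne'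
  have hs0 : 0 ≤ s := by linarith
  have hsa₁ : s * a₁ ≤ 1 := hsm ▸ mul_le_mul_of_nonneg_left (le_max_left _ _) hs0
  have hsa₂ : s * a₂ ≤ 1 := hsm ▸ mul_le_mul_of_nonneg_left (le_max_right _ _) hs0
  obtain ⟨h1, h2⟩ := revenueBound_le_of_normalized (a₁ := s * a₁) (a₂ := s * a₂) hx0 hx1 hy0 hy1
    ⟨mul_nonneg hs0 ha₁.1, hsa₁⟩ ⟨mul_nonneg hs0 ha₂.1, hsa₂⟩ hb₁ hb₂
    (by have := mul_pos (by linarith : 0 < s) hD; linarith)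
    (by rcases max_choice a₁ a₂ with h | h
        · left; rw [← h]; exact hsm
        · right; rw [← h]; exact hsm) hb
  -- The given scale 1 is a mixture of `r` and `s`. The bound at `r` is strictly below 59/108, so
  -- equality forces θ = 1 and hence `s = 1`.
  set θ := (1 - r) / (s - r) with hθ
  have hsr : 0 < s - r := by linarith
  have hθ0 : 0 < θ := div_pos (by linarith) hsr
  have hθ1 : θ ≤ 1 := (div_le_one hsr).2 (by linarith)
  have hcomb : (1 - θ) * r + θ * s = 1 := by
    rw [hθ]; field_simp; ring
  have hconv := revenueBound_convex hx0 hy0 hθ0.le hθ1 hr0 hs0 a₁ a₂ b₁ b₂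
  rw [hcomb, one_mul, one_mul] at hconv
  have k1 := mul_le_mul_of_nonneg_left hr (sub_nonneg.2 hθ1)
  have k2 := mul_le_mul_of_nonneg_left h1 hθ0.le
  refine ⟨by linarith, fun he => ?_⟩
  have hθe : θ = 1 := by linarith
  have hse : s = 1 := by rw [hθe] at hcomb; linarith
  rw [hse, one_mul, one_mul] at h1 h2
  exact h2 (le_antisymm h1 (by linarith))

/-- The best revenue from two items that both give utility `0` at `(x, y)`. -/
theorem revenueAt_le (hx0 : 0 ≤ x) (hx1 : x ≤ 1) (hy0 : 0 ≤ y)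
    (hy1 : y ≤ 1) (ha₁ : a₁ ∈ Icc (0 : ℝ) 1) (ha₂ : a₂ ∈ Icc (0 : ℝ) 1)
    (hb₁ : b₁ ∈ Icc (0 : ℝ) 1) (hb₂ : b₂ ∈ Icc (0 : ℝ) 1) (hD : 0 < a₁ * b₂ - a₂ * b₁) :
    revenueAt x y a₁ a₂ b₁ b₂ ≤ 59 / 108 ∧
      (revenueAt x y a₁ a₂ b₁ b₂ = 59 / 108 → IsOptimalParam x y a₁ a₂ b₁ b₂) := by
  set m := max (max a₁ a₂) (max b₁ b₂) with hm
  have ma₁ : a₁ ≤ m := (le_max_left _ _).trans (le_max_left _ _)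
  have ma₂ : a₂ ≤ m := (le_max_right _ _).trans (le_max_left _ _)
  have mb₁ : b₁ ≤ m := (le_max_left _ _).trans (le_max_right _ _)
  have mb₂ : b₂ ≤ m := (le_max_right _ _).trans (le_max_right _ _)
  have hm1 : m ≤ 1 := max_le (max_le ha₁.2 ha₂.2) (max_le hb₁.2 hb₂.2)
  have hm0 : 0 < m := by
    rcases (ha₁.1.trans ma₁).eq_or_lt with h | h
    · have h1 : a₁ = 0 := le_antisymm (h ▸ ma₁) ha₁.1
      have h2 : a₂ = 0 := le_antisymm (h ▸ ma₂) ha₂.1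
      rw [h1, h2] at hD
      simp at hD
    · exact h
  -- By homogeneity the revenue is `m` times that of the rescaled items, so equality requires `m =
  -- 1`.
  have hsc := revenueAt_smul hm0.le x y (a₁ / m) (a₂ / m) (b₁ / m) (b₂ / m)
  simp only [mul_div_cancel₀ _ hm0.ne'] at hsc
  have hmem : ∀ {z : ℝ}, 0 ≤ z → z ≤ m → z / m ∈ Icc (0 : ℝ) 1 := fun h h' =>
    ⟨div_nonneg h hm0.le, (div_le_one hm0).2 h'⟩
  have hD' : 0 < a₁ / m * (b₂ / m) - a₂ / m * (b₁ / m) := by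
    have : a₁ / m * (b₂ / m) - a₂ / m * (b₁ / m) = (a₁ * b₂ - a₂ * b₁) / m ^ 2 := by
      field_simp
    rw [this]; positivity
  have hone : ∀ {z : ℝ}, m = z → z / m = 1 := fun h => by rw [← h]; exact div_self hm0.ne'
  have main : revenueAt x y (a₁ / m) (a₂ / m) (b₁ / m) (b₂ / m) ≤ 59 / 108 ∧
      (revenueAt x y (a₁ / m) (a₂ / m) (b₁ / m) (b₂ / m) = 59 / 108 →
        IsOptimalParam x y (a₁ / m) (a₂ / m) (b₁ / m) (b₂ / m)) := by
    rcases max_choice (max a₁ a₂) (max b₁ b₂) with h | h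
    · rw [← revenueAt_mirror]
      obtain ⟨h1, h2⟩ := revenueAt_le_of_second_normalized hy0 hy1 hx0 hx1 (hmem hb₂.1 mb₂)
        (hmem hb₁.1 mb₁) (hmem ha₂.1 ma₂) (hmem ha₁.1 ma₁) (by linarith)
        (by rcases max_choice a₁ a₂ with h' | h'
            · exact Or.inr (hone (h.trans h'))
            · exact Or.inl (hone (h.trans h')))
      exact ⟨h1, fun he => (h2 he).mirror⟩
    · exact revenueAt_le_of_second_normalized hx0 hx1 hy0 hy1 (hmem ha₁.1 ma₁)
        (hmem ha₂.1 ma₂) (hmem hb₁.1 mb₁) (hmem hb₂.1 mb₂) hD'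
        (by rcases max_choice b₁ b₂ with h' | h'
            · exact Or.inl (hone (h.trans h'))
            · exact Or.inr (hone (h.trans h')))
  obtain ⟨h1, h2⟩ := main
  have k := mul_le_mul_of_nonneg_left h1 hm0.le
  rw [hsc]
  refine ⟨by linarith, fun he => ?_⟩
  have hme : m = 1 := by linarith
  simp only [hme, div_one, one_mul] at h2 he
  exact h2 he

end

/-! ### Existence of a common zero -/

theorem exists_convex_zero {u v : ℝ} (hu : u ≤ 0) (hv : 0 < v) :
    ∃ θ : ℝ, 0 ≤ θ ∧ θ ≤ 1 ∧ (1 - θ) * u + θ * v = 0 := by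
  have h : 0 < v - u := by linarith
  refine ⟨-u / (v - u), div_nonneg (by linarith) h.le, (div_le_one h).2 (by linarith), ?_⟩
  field_simp; ring

/-- If neither of two items is attractive only where the other one is, then there is a point of
the unit square at which both give utility `0`. -/
theorem exists_common_zero {a₁ a₂ p b₁ b₂ q : ℝ} (ha₁ : 0 ≤ a₁) (ha₂ : 0 ≤ a₂) (hp : 0 ≤ p)
    (hb₁ : 0 ≤ b₁) (hb₂ : 0 ≤ b₂) (hq : 0 ≤ q) {v w : ℝ × ℝ}
    (hv : v ∈ Icc (0 : ℝ) 1 ×ˢ Icc (0 : ℝ) 1) (hw : w ∈ Icc (0 : ℝ) 1 ×ˢ Icc (0 : ℝ) 1)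
    (hfv : a₁ * v.1 + a₂ * v.2 - p ≤ 0) (hgv : 0 < b₁ * v.1 + b₂ * v.2 - q)
    (hfw : 0 < a₁ * w.1 + a₂ * w.2 - p) (hgw : b₁ * w.1 + b₂ * w.2 - q ≤ 0) :
    ∃ x ∈ Icc (0 : ℝ) 1, ∃ y ∈ Icc (0 : ℝ) 1, a₁ * x + a₂ * y = p ∧ b₁ * x + b₂ * y = q ∧
      a₁ * b₂ - a₂ * b₁ ≠ 0 := by
  obtain ⟨⟨hv1, hv1'⟩, hv2, hv2'⟩ := hv
  obtain ⟨⟨hw1, hw1'⟩, hw2, hw2'⟩ := hw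
  have hconv : ∀ {θ s t : ℝ}, 0 ≤ θ → θ ≤ 1 → s ∈ Icc (0 : ℝ) 1 → t ∈ Icc (0 : ℝ) 1 →
      (1 - θ) * s + θ * t ∈ Icc (0 : ℝ) 1 := fun h0 h1 hs ht =>
    convex_Icc (0 : ℝ) 1 hs ht (by linarith) h0 (by ring)
  have hf1 : 0 < a₁ * 1 + a₂ * 1 - p := by
    nlinarith [mul_nonneg ha₁ (sub_nonneg.2 hw1'), mul_nonneg ha₂ (sub_nonneg.2 hw2')]
  have hg1 : 0 < b₁ * 1 + b₂ * 1 - q := by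
    nlinarith [mul_nonneg hb₁ (sub_nonneg.2 hv1'), mul_nonneg hb₂ (sub_nonneg.2 hv2')]
  -- The first utility vanishes somewhere between `v` and (1, 1), where the second is positive, and
  -- somewhere between the origin and `w`, where the second is nonpositive. On the segment joining
  -- these two points the first stays zero and the second reaches zero.
  obtain ⟨θ, hθ0, hθ1, hθ⟩ := exists_convex_zero hfv hf1
  obtain ⟨φ, hφ0, hφ1, hφ⟩ := exists_convex_zero (by linarith : -p ≤ 0) hfw
  have hgθ : 0 < b₁ * ((1 - θ) * v.1 + θ * 1) + b₂ * ((1 - θ) * v.2 + θ * 1) - q := by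
    rcases hθ0.eq_or_lt with h | h
    · rw [← h]; linarith
    · nlinarith [mul_pos h hg1, mul_nonneg (sub_nonneg.2 hθ1) hgv.le]
  have hgφ : b₁ * (φ * w.1) + b₂ * (φ * w.2) - q ≤ 0 := by
    nlinarith [mul_nonneg hφ0 (neg_nonneg.2 hgw), mul_nonneg (sub_nonneg.2 hφ1) hq]
  obtain ⟨ψ, hψ0, hψ1, hψ⟩ := exists_convex_zero hgφ hgθ
  have hz : (0 : ℝ) ∈ Icc (0 : ℝ) 1 := ⟨le_rfl, zero_le_one⟩
  have ho : (1 : ℝ) ∈ Icc (0 : ℝ) 1 := ⟨zero_le_one, le_rfl⟩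
  have hx := hconv hψ0 hψ1 (hconv hφ0 hφ1 hz ⟨hw1, hw1'⟩) (hconv hθ0 hθ1 ⟨hv1, hv1'⟩ ho)
  have hy := hconv hψ0 hψ1 (hconv hφ0 hφ1 hz ⟨hw2, hw2'⟩) (hconv hθ0 hθ1 ⟨hv2, hv2'⟩ ho)
  refine ⟨_, hx, _, hy, ?_, ?_, ?_⟩
  · linear_combination (1 - ψ) * hφ + ψ * hθ
  · linear_combination hψ
  · set x := (1 - ψ) * ((1 - φ) * 0 + φ * w.1) + ψ * ((1 - θ) * v.1 + θ * 1) with hxdef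
    set y := (1 - ψ) * ((1 - φ) * 0 + φ * w.2) + ψ * ((1 - θ) * v.2 + θ * 1) with hydef
    have hfx : a₁ * x + a₂ * y = p := by
      rw [hxdef, hydef]; linear_combination (1 - ψ) * hφ + ψ * hθ
    have hgx : b₁ * x + b₂ * y = q := by
      rw [hxdef, hydef]; linear_combination hψ
    -- If the determinant were zero, the utilities at `v` would be proportional as the allocations
    -- are; their signs then force the first allocation to vanish, although the first item is
    -- attractive at `w`.
    intro hD
    have e1 : (a₁ * v.1 + a₂ * v.2 - p) * b₁ = a₁ * (b₁ * v.1 + b₂ * v.2 - q) := by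
      rw [← hfx, ← hgx]; linear_combination (y - v.2) * hD
    have e2 : (a₁ * v.1 + a₂ * v.2 - p) * b₂ = a₂ * (b₁ * v.1 + b₂ * v.2 - q) := by
      rw [← hfx, ← hgx]; linear_combination (v.1 - x) * hD
    have z1 : a₁ = 0 := by
      by_contra h
      have := mul_pos (lt_of_le_of_ne ha₁ (Ne.symm h)) hgv
      nlinarith [mul_nonneg (neg_nonneg.2 hfv) hb₁]
    have z2 : a₂ = 0 := by
      by_contra h
      have := mul_pos (lt_of_le_of_ne ha₂ (Ne.symm h)) hgv
      nlinarith [mul_nonneg (neg_nonneg.2 hfv) hb₂]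
    rw [z1, z2] at hfw
    linarith

/-! ### From items back to mechanisms -/

theorem eq_sell_singleton_zero {o : Outcome 2} (h0 : o.alloc 0 = 1) (h1 : o.alloc 1 = 0)
    (hp : o.price = 2 / 3) : o = Outcome.sell {0} (2 / 3) (by norm_num) := by
  refine Outcome.ext (funext fun i => ?_) hp
  fin_cases i
  · simpa [Outcome.sell] using h0
  · simpa [Outcome.sell] using h1

theorem eq_sell_singleton_one {o : Outcome 2} (h0 : o.alloc 0 = 0) (h1 : o.alloc 1 = 1)
    (hp : o.price = 2 / 3) : o = Outcome.sell {1} (2 / 3) (by norm_num) := by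
  refine Outcome.ext (funext fun i => ?_) hp
  fin_cases i
  · simpa [Outcome.sell] using h0
  · simpa [Outcome.sell] using h1

theorem eq_sell_univ {o : Outcome 2} (h0 : o.alloc 0 = 1) (h1 : o.alloc 1 = 1)
    (hp : o.price = 5 / 6) : o = Outcome.sell Finset.univ (5 / 6) (by norm_num) := by
  refine Outcome.ext (funext fun i => ?_) hp
  fin_cases i
  · simpa [Outcome.sell] using h0
  · simpa [Outcome.sell] using h1

section Mechanism

variable {A : Type*} {M : NaiveMechanism 2 A} {s : (Fin 2 → ℝ) → A} {o o' : Outcome 2}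

theorem revenue_le_of_common_zero (hM : M.menu = {Outcome.zero 2, o, o'})
    (hs : M.IsRational unitSquare s) {x y : ℝ} (hx : x ∈ Icc (0 : ℝ) 1) (hy : y ∈ Icc (0 : ℝ) 1)
    (ho : o.alloc 0 * x + o.alloc 1 * y = o.price)
    (ho' : o'.alloc 0 * x + o'.alloc 1 * y = o'.price)
    (hD : 0 < o.alloc 0 * o'.alloc 1 - o.alloc 1 * o'.alloc 0) :
    M.revenue uniformSquare s ≤ 59 / 108 ∧
      (M.revenue uniformSquare s = 59 / 108 →
        M.menu = itemOrBundleMenu 0 ∨ M.menu = itemOrBundleMenu 1) := by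
  have h := (revenue_eq hM hs).2
  have h' := revenueAt_eq x y (o.alloc 0) (o.alloc 1) (o'.alloc 0) (o'.alloc 1)
  rw [ho, ho'] at h'
  rw [h, h']
  obtain ⟨h1, h2⟩ := revenueAt_le hx.1 hx.2 hy.1 hy.2 (o.alloc_mem 0) (o.alloc_mem 1)
    (o'.alloc_mem 0) (o'.alloc_mem 1) hD
  refine ⟨h1, fun he => ?_⟩
  rcases h2 he with ⟨r1, r2, r3, r4, r5, r6⟩ | ⟨r1, r2, r3, r4, r5, r6⟩
  · left
    rw [r1, r2, r3, r4] at ho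
    rw [r1, r2, r5, r6] at ho'
    rw [hM, itemOrBundleMenu, eq_sell_singleton_zero r3 r4 (by rw [← ho]; norm_num),
      eq_sell_univ r5 r6 (by rw [← ho']; norm_num)]
  · right
    rw [r1, r2, r3, r4] at ho
    rw [r1, r2, r5, r6] at ho'
    rw [hM, itemOrBundleMenu, eq_sell_univ r3 r4 (by rw [← ho]; norm_num),
      eq_sell_singleton_one r5 r6 (by rw [← ho']; norm_num),
      Set.pair_comm (Outcome.sell Finset.univ _ _)]

theorem revenue_le_of_menu_eq (hM : M.menu = {Outcome.zero 2, o, o'})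
    (hs : M.IsRational unitSquare s) :
    M.revenue uniformSquare s ≤ 59 / 108 ∧
      (M.revenue uniformSquare s = 59 / 108 →
        M.menu = itemOrBundleMenu 0 ∨ M.menu = itemOrBundleMenu 1) := by
  have hM' : M.menu = {Outcome.zero 2, o', o} := by rw [hM, Set.pair_comm]
  have hlt : M.revenue uniformSquare s ≤ 109 / 200 → M.revenue uniformSquare s ≤ 59 / 108 ∧
      (M.revenue uniformSquare s = 59 / 108 →
        M.menu = itemOrBundleMenu 0 ∨ M.menu = itemOrBundleMenu 1) := fun h =>
    ⟨by linarith, fun h' => by linarith⟩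
  by_cases hN : ∀ z : ℝ × ℝ, 0 ≤ z.1 → z.1 ≤ 1 → 0 ≤ z.2 → z.2 ≤ 1 →
      0 < o'.alloc 0 * z.1 + o'.alloc 1 * z.2 - o'.price →
      0 < o.alloc 0 * z.1 + o.alloc 1 * z.2 - o.price
  · apply hlt
    rw [(revenue_eq hM hs).2]
    exact revenue_le_of_nested (o.alloc_mem 0) (o.alloc_mem 1) o.price_nonneg (o'.alloc_mem 0)
      (o'.alloc_mem 1) hN
  by_cases hN' : ∀ z : ℝ × ℝ, 0 ≤ z.1 → z.1 ≤ 1 → 0 ≤ z.2 → z.2 ≤ 1 →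
      0 < o.alloc 0 * z.1 + o.alloc 1 * z.2 - o.price →
      0 < o'.alloc 0 * z.1 + o'.alloc 1 * z.2 - o'.price
  · apply hlt
    rw [(revenue_eq hM' hs).2]
    exact revenue_le_of_nested (o'.alloc_mem 0) (o'.alloc_mem 1) o'.price_nonneg (o.alloc_mem 0)
      (o.alloc_mem 1) hN'
  push Not at hN hN'
  obtain ⟨v, v1, v2, v3, v4, hgv, hfv⟩ := hN
  obtain ⟨w, w1, w2, w3, w4, hfw, hgw⟩ := hN'
  obtain ⟨x, hx, y, hy, ho, ho', hD⟩ := exists_common_zero (o.alloc_mem 0).1 (o.alloc_mem 1).1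
    o.price_nonneg (o'.alloc_mem 0).1 (o'.alloc_mem 1).1 o'.price_nonneg
    (v := v) (w := w) ⟨⟨v1, v2⟩, v3, v4⟩ ⟨⟨w1, w2⟩, w3, w4⟩ hfv hgv hfw hgw
  rcases lt_or_gt_of_ne hD with h | h
  · exact revenue_le_of_common_zero hM' hs hx hy ho' ho (by linarith)
  · exact revenue_le_of_common_zero hM hs hx hy ho ho' h

/-- Smaller menus are padded by repeating an item, so the outcomes need not be distinct. -/
theorem exists_menu_eq (h : M.menu.encard ≤ 3) :
    ∃ o o', M.menu = {Outcome.zero 2, o, o'} := by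
  have h0 : Outcome.zero 2 ∈ M.menu := ⟨M.exit, M.outcome_exit⟩
  have h1 : (M.menu \ {Outcome.zero 2}).encard ≤ 2 := by
    have := encard_sdiff_singleton_add_one h0
    rw [← this] at h
    exact (ENat.add_le_add_iff_right ENat.one_ne_top).1 (h.trans_eq (by norm_num))
  have hins : M.menu = insert (Outcome.zero 2) (M.menu \ {Outcome.zero 2}) := by
    rw [insert_sdiff_singleton, insert_eq_of_mem h0]
  rcases (M.menu \ {Outcome.zero 2}).eq_empty_or_nonempty with he | ⟨o, ho⟩
  · refine ⟨Outcome.zero 2, Outcome.zero 2, ?_⟩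
    rw [hins, he]; simp
  · have h2 : ((M.menu \ {Outcome.zero 2}) \ {o}).encard ≤ 1 := by
      have := encard_sdiff_singleton_add_one ho
      rw [← this] at h1
      exact (ENat.add_le_add_iff_right ENat.one_ne_top).1 (h1.trans_eq (by norm_num))
    have hins' : M.menu \ {Outcome.zero 2} =
        insert o ((M.menu \ {Outcome.zero 2}) \ {o}) := by
      rw [insert_sdiff_singleton, insert_eq_of_mem ho]
    rcases encard_le_one_iff_eq.1 h2 with he | ⟨o', he⟩
    · refine ⟨o, o, ?_⟩
      rw [hins, hins', he]; simp
    · refine ⟨o, o', ?_⟩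
      rw [hins, hins', he]

/-! ### Revenue, asymmetry and existence for the two optimal menus -/

theorem revenueAt_optimal : revenueAt (2 / 3) (1 / 6) 1 0 1 1 = 59 / 108 := by
  have e1 : edge (1 - 2 / 3) (1 / 6) 1 0 1 1 = 49 / 72 := by
    have h : ∀ t : ℝ, max 0 (max (1 * (1 - 2 / 3) + 0 * (t - 1 / 6))
        (1 * (1 - 2 / 3) + 1 * (t - 1 / 6))) = 1 / 3 + max 0 (t - 1 / 6) := by
      intro t
      simp only [max_def]
      split_ifs <;> linarith
    unfold edge
    simp only [h]
    rw [intervalIntegral.integral_add (by simp)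
      (Continuous.intervalIntegrable (by fun_prop) _ _), integral_pos_part_sub (by norm_num)]
    norm_num
  have e2 : edge (-(2 / 3)) (1 / 6) 1 0 1 1 = 1 / 72 := by
    have h : ∀ t : ℝ, max 0 (max (1 * -(2 / 3) + 0 * (t - 1 / 6))
        (1 * -(2 / 3) + 1 * (t - 1 / 6))) = max 0 (t - 5 / 6) := by
      intro t
      simp only [max_def]
      split_ifs <;> linarith
    unfold edge
    simp only [h]
    rw [integral_pos_part_sub (by norm_num)]
    norm_num
  have e3 : edge (1 - 1 / 6) (2 / 3) 0 1 1 1 = 2 / 3 := by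
    have h : ∀ t ∈ uIcc (0 : ℝ) 1, max 0 (max (0 * (1 - 1 / 6) + 1 * (t - 2 / 3))
        (1 * (1 - 1 / 6) + 1 * (t - 2 / 3))) = 1 / 6 + t := by
      intro t ht
      rw [uIcc_of_le zero_le_one] at ht
      have := ht.1
      simp only [max_def]
      split_ifs <;> linarith
    unfold edge
    rw [intervalIntegral.integral_congr h, intervalIntegral.integral_add (by simp) (by simp)]
    norm_num
  have e4 : edge (-(1 / 6)) (2 / 3) 0 1 1 1 = 1 / 18 := by
    have h : ∀ t : ℝ, max 0 (max (0 * -(1 / 6) + 1 * (t - 2 / 3))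
        (1 * -(1 / 6) + 1 * (t - 2 / 3))) = max 0 (t - 2 / 3) := by
      intro t
      simp only [max_def]
      split_ifs <;> linarith
    unfold edge
    simp only [h]
    rw [integral_pos_part_sub (by norm_num)]
    norm_num
  rw [revenueAt, e1, e2, e3, e4]
  norm_num

theorem revenue_of_menu_zero (hM : M.menu = itemOrBundleMenu 0)
    (hs : M.IsRational unitSquare s) : M.revenue uniformSquare s = 59 / 108 := by
  have h := (revenue_eq hM hs).2
  have h' := revenueAt_eq (2 / 3) (1 / 6) 1 0 1 1
  rw [revenueAt_optimal] at h'
  norm_num at h'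
  rw [h]
  simpa [Outcome.sell] using h'

theorem revenue_of_menu_one (hM : M.menu = itemOrBundleMenu 1)
    (hs : M.IsRational unitSquare s) : M.revenue uniformSquare s = 59 / 108 := by
  rw [itemOrBundleMenu, Set.pair_comm] at hM
  have h := (revenue_eq hM hs).2
  have h' := revenueAt_eq (1 / 6) (2 / 3) 1 1 0 1
  rw [revenueAt_mirror, revenueAt_optimal] at h'
  norm_num at h'
  rw [h]
  simpa [Outcome.sell] using h'

theorem revenue_of_menu (i : Fin 2) (hM : M.menu = itemOrBundleMenu i)
    (hs : M.IsRational unitSquare s) : M.revenue uniformSquare s = 59 / 108 := by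
  fin_cases i
  · exact revenue_of_menu_zero hM hs
  · exact revenue_of_menu_one hM hs

theorem relabel_image_itemOrBundleMenu (σ : Equiv.Perm (Fin 2)) (i : Fin 2) :
    Outcome.relabel σ '' itemOrBundleMenu i = itemOrBundleMenu (σ i) := by
  have h0 : Outcome.relabel σ (Outcome.zero 2) = Outcome.zero 2 := rfl
  have h1 : Outcome.relabel σ (Outcome.sell {i} (2 / 3) (by norm_num)) =
      Outcome.sell {σ i} (2 / 3) (by norm_num) := by
    refine Outcome.ext (funext fun j => ?_) rfl
    simp [Outcome.relabel, Outcome.sell, Equiv.symm_apply_eq]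
  have h2 : Outcome.relabel σ (Outcome.sell Finset.univ (5 / 6) (by norm_num)) =
      Outcome.sell Finset.univ (5 / 6) (by norm_num) := by
    refine Outcome.ext (funext fun j => ?_) rfl
    simp [Outcome.relabel, Outcome.sell]
  rw [itemOrBundleMenu, itemOrBundleMenu, image_insert_eq, image_insert_eq, image_singleton,
    h0, h1, h2]

theorem itemOrBundleMenu_injective : Function.Injective itemOrBundleMenu := by
  intro i j h
  have hmem : Outcome.sell {i} (2 / 3) (by norm_num) ∈ itemOrBundleMenu j := by
    rw [← h]; simp [itemOrBundleMenu]
  rw [itemOrBundleMenu] at hmem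
  rcases hmem with h | h | h
  · have := congrArg Outcome.price h
    norm_num [Outcome.sell, Outcome.zero] at this
  · have := congrArg (fun o => Outcome.alloc o i) h
    simpa [Outcome.sell] using this
  · have := congrArg Outcome.price h
    norm_num [Outcome.sell] at this

theorem not_isSymmetric_of_menu (i : Fin 2) (hM : M.menu = itemOrBundleMenu i) :
    ¬ M.IsSymmetric := by
  intro h
  have := h (Equiv.swap 0 1)
  rw [hM, relabel_image_itemOrBundleMenu] at this
  have := itemOrBundleMenu_injective this
  fin_cases i <;> simp at this

end Mechanism

theorem encard_itemOrBundleMenu (i : Fin 2) : (itemOrBundleMenu i).encard = 3 := by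
  rw [itemOrBundleMenu, encard_insert_of_notMem, encard_pair]
  · norm_num
  · intro h
    have := congrArg Outcome.price h
    norm_num [Outcome.sell] at this
  · rintro (h | h)
    all_goals
      have := congrArg Outcome.price h
      norm_num [Outcome.sell, Outcome.zero] at this

theorem exists_mechanism (o o' : Outcome 2) :
    ∃ (M : NaiveMechanism 2 (Fin 3)) (s : (Fin 2 → ℝ) → Fin 3),
      M.menu = {Outcome.zero 2, o, o'} ∧ M.IsRational unitSquare s := by
  let M : NaiveMechanism 2 (Fin 3) := ⟨![Outcome.zero 2, o, o'], 0, rfl⟩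
  choose s hs using fun v : Fin 2 → ℝ => Finite.exists_max fun a => (M.outcome a).utility v
  refine ⟨M, s, ?_, fun v _ a => hs v a⟩
  show range ![Outcome.zero 2, o, o'] = _
  ext z
  constructor
  · rintro ⟨i, rfl⟩
    fin_cases i <;> simp
  · rintro (rfl | rfl | rfl)
    exacts [⟨0, rfl⟩, ⟨1, rfl⟩, ⟨2, rfl⟩]

theorem map_uniformSquare (σ : Equiv.Perm (Fin 2)) :
    uniformSquare.map (fun v i => v (σ.symm i)) = uniformSquare := by
  have h := volume_measurePreserving_piCongrLeft (fun _ : Fin 2 => ℝ) σ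
  have h' := h.restrict_preimage_emb (MeasurableEquiv.measurableEmbedding _) unitSquare
  have e : (MeasurableEquiv.piCongrLeft (fun _ : Fin 2 => ℝ) σ : (Fin 2 → ℝ) → Fin 2 → ℝ) =
      fun v i => v (σ.symm i) := by
    funext v i
    obtain ⟨j, rfl⟩ := σ.surjective i
    simp [MeasurableEquiv.coe_piCongrLeft]
  have hs : (MeasurableEquiv.piCongrLeft (fun _ : Fin 2 => ℝ) σ) ⁻¹' unitSquare = unitSquare := by
    rw [e]
    ext v
    simp only [unitSquare, mem_preimage, mem_Icc, Pi.le_def]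
    constructor
    · rintro ⟨h1, h2⟩
      exact ⟨fun i => by simpa using h1 (σ i), fun i => by simpa using h2 (σ i)⟩
    · rintro ⟨h1, h2⟩
      exact ⟨fun i => h1 (σ.symm i), fun i => h2 (σ.symm i)⟩
  rw [hs, e] at h'
  exact h'.map_eq

end MenuDesign

end

theorem mainTheorem2 :
    -- each of the two menus is a menu of size three, offered by a mechanism to which the
    -- buyer has a rational response, and it yields revenue `59 / 108`
    (∀ i : Fin 2, (MenuDesign.itemOrBundleMenu i).encard = 3 ∧
      ∃ (M : MenuDesign.NaiveMechanism 2 (Fin 3)) (s : (Fin 2 → ℝ) → Fin 3),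
        M.menu = MenuDesign.itemOrBundleMenu i ∧
        M.IsRational MenuDesign.unitSquare s ∧
        M.revenue MenuDesign.uniformSquare s = 59 / 108) ∧
    -- no mechanism with at most three menu items does better, and no other one does as well
    (∀ {A : Type*} (M : MenuDesign.NaiveMechanism 2 A) (s : (Fin 2 → ℝ) → A),
      M.menu.encard ≤ 3 → M.IsRational MenuDesign.unitSquare s →
        MeasureTheory.Integrable (M.payment s) MenuDesign.uniformSquare ∧
        M.revenue MenuDesign.uniformSquare s ≤ 59 / 108 ∧
        (M.revenue MenuDesign.uniformSquare s = 59 / 108 ↔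
          M.menu = MenuDesign.itemOrBundleMenu 0 ∨
          M.menu = MenuDesign.itemOrBundleMenu 1) ∧
        (M.revenue MenuDesign.uniformSquare s = 59 / 108 → ¬ M.IsSymmetric)) ∧
    -- the two menus are mirror images of each other, and the distribution is symmetric
    MenuDesign.Outcome.relabel (Equiv.swap 0 1) '' MenuDesign.itemOrBundleMenu 0 =
      MenuDesign.itemOrBundleMenu 1 ∧
    (∀ σ : Equiv.Perm (Fin 2),
      MenuDesign.uniformSquare.map (fun v i => v (σ.symm i)) = MenuDesign.uniformSquare) := by
  refine ⟨fun i => ⟨MenuDesign.encard_itemOrBundleMenu i, ?_⟩, ?_, ?_,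
    MenuDesign.map_uniformSquare⟩
  · obtain ⟨M, s, hM, hs⟩ := MenuDesign.exists_mechanism
      (MenuDesign.Outcome.sell {i} (2 / 3) (by norm_num))
      (MenuDesign.Outcome.sell Finset.univ (5 / 6) (by norm_num))
    exact ⟨M, s, hM, hs, MenuDesign.revenue_of_menu i hM hs⟩
  · intro A M s hcard hs
    obtain ⟨o, o', hM⟩ := MenuDesign.exists_menu_eq hcard
    obtain ⟨hle, heq⟩ := MenuDesign.revenue_le_of_menu_eq hM hs
    refine ⟨(MenuDesign.revenue_eq hM hs).1, hle, ⟨heq, ?_⟩, fun h => ?_⟩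
    · rintro (h | h)
      · exact MenuDesign.revenue_of_menu 0 h hs
      · exact MenuDesign.revenue_of_menu 1 h hs
    · rcases heq h with h' | h'
      · exact MenuDesign.not_isSymmetric_of_menu 0 h'
      · exact MenuDesign.not_isSymmetric_of_menu 1 h'
  · rw [MenuDesign.relabel_image_itemOrBundleMenu]
    simp
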